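/- Let $\Sigma$ be a smooth $2$-manifold, $(M,g)$ a smooth Riemannian $3$-manifold, both oriented (locally, by the coordinates in use), and let $f:\Sigma\to M$ be a frontal, i.e. a $C^\infty$ map such that near every point there is a smooth unit vector field $\nu$ along $f$ perpendicular to the image of $df$. A point $p$ is a singular point if $df_p$ is not injective; it is non-degenerate if $d\lambda_p\neq 0$, where $\lambda=\det_g(f_u,f_v,\nu)$ in local coordinates $(u,v)$. Near such a point the singular set is parametrized by a regular curve $\gamma(t)$, $|t|<\varepsilon$, $\gamma(0)=p$. The point $p$ is of the first kind if it is non-degenerate and $\ker df_p$ is not spanned by $\gamma'(0)$. Assume that $p$ is a singular point of the first kind. Let $\eta$ be a non-vanishing smooth vector field near $p$ such that $df(\eta)=0$ along $\gamma$ and $\{\gamma',\eta\}$ is positively oriented along $\gamma$. Put $\hat\gamma=f\circ\gamma$, $f_\eta=df(\eta)$, $f_{\eta\eta}=\nabla_\eta f_\eta$, $f_{\eta\eta\eta}=\nabla_\eta f_{\eta\eta}$, with $\nabla$ the Levi-Civita connection of $g$, and $$\kappa_c(t)=\frac{|\hat\gamma'(t)|^{3/2}\,\det_g\bigl(\hat\gamma'(t),f_{\eta\eta}(\gamma(t)),f_{\eta\eta\eta}(\gamma(t))\bigr)}{\bigl|\hat\gamma'(t)\times_g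 f_{\eta\eta}(\gamma(t))\bigr|^{5/2}},\qquad \kappa_c(p)=\kappa_c(0),\qquad \kappa_c'(p)=\frac{d\kappa_c}{ds}\Big|_{p},$$ where $s$ is the arclength parameter of $\hat\gamma$, i.e. $\kappa_c'(p)=\frac{1}{|\hat\gamma'(0)|}\frac{d\kappa_c}{dt}(0)$. Let $H$ be the mean curvature of $f$ with respect to $\nu$, defined on the set of regular (non-singular) points of $f$ near $p$. Let $\pi$ be the projection onto $\Sigma$ of the blow-up of $\Sigma$ at $p$, i.e., in local coordinates $(u,v)$ centered at $p$, $\pi([r,\theta])=(r\cos\theta,r\sin\theta)$ on the quotient of $\mathbf R\times\mathbf R/2\pi\mathbf Z$ by $(r,\theta)\sim(-r,\theta+\pi)$. A $C^\infty$ function $\varphi$ on an open dense subset $O$ of a neighborhood $U$ of $p$ is rationally bounded at $p$ if there are $C^\infty$ functions $\Lambda,\psi:\pi^{-1}(U)\to\mathbf R$ such that $\pi^{-1}(O\setminus\{p\})=\pi^{-1}(U\setminus\{p\})\cap\{\Lambda\ne0\}$, the set $\{\Lambda=0\}\cap\pi^{-1}(p)$ is finite, and $\psi=\Lambda\cdot(\varphi\circ\pi)$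 on $\pi^{-1}(O)$. It is rationally continuous at $p$ if, for some such $\Lambda,\psi$, there is moreover a constant $c$ with $\psi=c\,\Lambda$ on $\pi^{-1}(p)$. These notions are applied to $H$ with $O$ the set of regular points in a sufficiently small neighborhood $U$ of $p$. Then: 1. $H$ is bounded near $p$ (on the regular points of some neighborhood of $p$) if and only if $\kappa_c$ vanishes on a neighborhood of $p$ in the singular set, i.e. $\kappa_c(t)=0$ for all $t$ close to $0$. 2. $H$ is rationally bounded at $p$ if and only if $\kappa_c(p)=0$. 3. $H$ is rationally continuous at $p$ if and only if $\kappa_c(p)=\kappa_c'(p)=0$. -/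

import Mathlib

open scoped ContDiff Manifold Topology

noncomputable section

namespace FrontalGeometry

/-- The plane, model of the source surface. -/
abbrev E2 := EuclideanSpace ℝ (Fin 2)

/-- The three-space, model of the ambient manifold. -/
abbrev E3 := EuclideanSpace ℝ (Fin 3)

/-- Standard basis vectors of the coordinate plane and of the coordinate three-space. -/
def du : E2 := EuclideanSpace.single 0 1
def dv : E2 := EuclideanSpace.single 1 1
def dx (i : Fin 3) : E3 := EuclideanSpace.single i 1

/-! ### Frontals into a Riemannian three-manifold -/

section Manifold

variable {S : Type*} [TopologicalSpace S] [ChartedSpace E2 S]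
  {M : Type*} [TopologicalSpace M] [ChartedSpace E3 M] [IsManifold 𝓘(ℝ, E3) ∞ M]

/-- A smooth Riemannian metric on the three-manifold `M`. -/
abbrev Metric3 (M : Type*) [TopologicalSpace M] [ChartedSpace E3 M]
    [IsManifold 𝓘(ℝ, E3) ∞ M] :=
  Bundle.ContMDiffRiemannianMetric 𝓘(ℝ, E3) ∞ E3 (fun x : M => TangentSpace 𝓘(ℝ, E3) x)

/-- `ν` is, on the set `U`, a smooth unit vector field along `f` perpendicular to the image
of `df`. -/
structure IsUnitNormalOn (g : Metric3 M) (f : S → M)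
    (ν : ∀ q : S, TangentSpace 𝓘(ℝ, E3) (f q)) (U : Set S) : Prop where
  smooth : ContMDiffOn 𝓘(ℝ, E2) 𝓘(ℝ, E3).tangent ∞
    (fun q => (⟨f q, ν q⟩ : TangentBundle 𝓘(ℝ, E3) M)) U
  unit : ∀ q ∈ U, g.inner (f q) (ν q) (ν q) = 1
  normal : ∀ q ∈ U, ∀ a : TangentSpace 𝓘(ℝ, E2) q,
    g.inner (f q) (mfderiv 𝓘(ℝ, E2) 𝓘(ℝ, E3) f q a) (ν q) = 0

/-- A frontal: a smooth map admitting a smooth unit normal field near every point. -/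
def IsFrontal (g : Metric3 M) (f : S → M) : Prop :=
  ContMDiff 𝓘(ℝ, E2) 𝓘(ℝ, E3) ∞ f ∧
    ∀ p : S, ∃ U : Set S, IsOpen U ∧ p ∈ U ∧
      ∃ ν : ∀ q : S, TangentSpace 𝓘(ℝ, E3) (f q), IsUnitNormalOn g f ν U

/-- The set of coordinates of points of `U` at which the coordinate expression of `f` in the charts
`e`, `e'` is meaningful. -/
def coordDomain (U : Set S) (f : S → M) (e : OpenPartialHomeomorph S E2)
    (e' : OpenPartialHomeomorph M E3) : Set E2 :=
  {x | x ∈ e.target ∧ e.symm x ∈ U ∧ f (e.symm x) ∈ e'.source}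

/-- The coordinate expression of `f`. -/
def coordMap (f : S → M) (e : OpenPartialHomeomorph S E2)
    (e' : OpenPartialHomeomorph M E3) : E2 → E3 :=
  fun x => e' (f (e.symm x))

/-- The components of a vector field along `f` in the coordinate frame of `e'`. -/
def coordField (f : S → M) (ν : ∀ q : S, TangentSpace 𝓘(ℝ, E3) (f q))
    (e : OpenPartialHomeomorph S E2) (e' : OpenPartialHomeomorph M E3) : E2 → E3 :=
  fun x => mfderiv 𝓘(ℝ, E3) 𝓘(ℝ, E3) e' (f (e.symm x)) (ν (e.symm x))

/-- The matrix of the metric in the coordinate frame of `e'`. -/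
def coordMetric (g : Metric3 M) (e' : OpenPartialHomeomorph M E3) :
    E3 → Matrix (Fin 3) (Fin 3) ℝ :=
  fun y => Matrix.of fun i j =>
    g.inner (e'.symm y) (mfderiv 𝓘(ℝ, E3) 𝓘(ℝ, E3) e'.symm y (dx i))
      (mfderiv 𝓘(ℝ, E3) 𝓘(ℝ, E3) e'.symm y (dx j))

end Manifold

/-! ### Riemannian geometry in local coordinates

`G` is the matrix of the metric, `F` the coordinate expression of the map, `N` the components of
the unit normal field. The coordinates are taken to be positively oriented. -/

/-- The inner product at `y`. -/
def ip (G : E3 → Matrix (Fin 3) (Fin 3) ℝ) (y a b : E3) : ℝ :=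
  ∑ i, ∑ j, G y i j * a i * b j

/-- The length of a tangent vector at `y`. -/
def len (G : E3 → Matrix (Fin 3) (Fin 3) ℝ) (y a : E3) : ℝ := √(ip G y a a)

/-- The Riemannian volume form at `y`. -/
def detg (G : E3 → Matrix (Fin 3) (Fin 3) ℝ) (y a b c : E3) : ℝ :=
  √((G y).det) * Matrix.det (Matrix.of ![a.ofLp, b.ofLp, c.ofLp])

/-- The vector product at `y`, i.e. the vector whose inner product with `c` is `detg G y a b c`. -/
def crossg (G : E3 → Matrix (Fin 3) (Fin 3) ℝ) (y a b : E3) : E3 :=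
  WithLp.toLp 2 (√((G y).det) • ((G y)⁻¹).mulVec (crossProduct a.ofLp b.ofLp))

/-- The Christoffel symbols `Γ^k_{ij}` of the Levi-Civita connection. -/
def christoffel (G : E3 → Matrix (Fin 3) (Fin 3) ℝ) (y : E3) (k i j : Fin 3) : ℝ :=
  (1 / 2) * ∑ l, (G y)⁻¹ k l *
    (fderiv ℝ (fun z => G z j l) y (dx i) + fderiv ℝ (fun z => G z i l) y (dx j)
      - fderiv ℝ (fun z => G z i j) y (dx l))

/-- The Levi-Civita covariant derivative `∇_X W` of a vector field `W` along `F` in the direction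
of the vector field `X` on the plane. -/
def covDeriv (G : E3 → Matrix (Fin 3) (Fin 3) ℝ) (F : E2 → E3) (X : E2 → E2) (W : E2 → E3) :
    E2 → E3 :=
  fun x => fderiv ℝ W x (X x) + WithLp.toLp 2 (fun k =>
    ∑ i, ∑ j, christoffel G (F x) k i j * (fderiv ℝ F x (X x)) i * W x j)

/-- Points at which `F` is not an immersion. -/
def singularSet (D : Set E2) (F : E2 → E3) : Set E2 :=
  {x | x ∈ D ∧ ¬ Function.Injective (fderiv ℝ F x)}

/-- Points at which `F` is an immersion. -/
def regularSet (D : Set E2) (F : E2 → E3) : Set E2 :=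
  {x | x ∈ D ∧ Function.Injective (fderiv ℝ F x)}

/-- The signed area density `det_g(f_u, f_v, ν)`. -/
def signedArea (G : E3 → Matrix (Fin 3) (Fin 3) ℝ) (F N : E2 → E3) (x : E2) : ℝ :=
  detg G (F x) (fderiv ℝ F x du) (fderiv ℝ F x dv) (N x)

/-- The mean curvature `(E N - 2 F M + G L) / (2 (E G - F²))`, where the second fundamental form
has coefficients `L = -⟨f_u, ∇_u ν⟩`, `M = -⟨f_u, ∇_v ν⟩`, `N = -⟨f_v, ∇_v ν⟩`. It is meaningful on
the regular set only. -/
def meanCurvature (G : E3 → Matrix (Fin 3) (Fin 3) ℝ) (F N : E2 → E3) (x : E2) : ℝ :=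
  let fu := fderiv ℝ F x du
  let fv := fderiv ℝ F x dv
  let Nu := covDeriv G F (fun _ => du) N x
  let Nv := covDeriv G F (fun _ => dv) N x
  (ip G (F x) fu fu * (-ip G (F x) fv Nv) - 2 * ip G (F x) fu fv * (-ip G (F x) fu Nv)
      + ip G (F x) fv fv * (-ip G (F x) fu Nu)) /
    (2 * (ip G (F x) fu fu * ip G (F x) fv fv - ip G (F x) fu fv ^ 2))

/-! ### Singular points of the first kind and the cuspidal curvature

The singular point under consideration is the origin of the coordinate plane. -/

/-- A regular curve on `(-ε, ε)`, starting from the origin, that parametrizes the singular set near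
the origin. -/
structure IsSingularCurve (D : Set E2) (F : E2 → E3) (ε : ℝ) (γ : ℝ → E2) : Prop where
  pos : 0 < ε
  smooth : ContDiffOn ℝ ∞ γ (Set.Ioo (-ε) ε)
  zero : γ 0 = 0
  regular : ∀ t ∈ Set.Ioo (-ε) ε, deriv γ t ≠ 0
  mem : ∀ t ∈ Set.Ioo (-ε) ε, γ t ∈ singularSet D F
  exhaust : ∀ᶠ x in 𝓝 (0 : E2), x ∈ singularSet D F → x ∈ γ '' Set.Ioo (-ε) ε

/-- The origin is a non-degenerate singular point. -/
def IsNondegenerate (D : Set E2) (G : E3 → Matrix (Fin 3) (Fin 3) ℝ) (F N : E2 → E3) : Prop :=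
  (0 : E2) ∈ singularSet D F ∧ fderiv ℝ (signedArea G F N) 0 ≠ 0

/-- The origin is a singular point of the first kind: it is non-degenerate, and the null direction
is not proportional to the direction of the singular curve. -/
def IsFirstKind (D : Set E2) (G : E3 → Matrix (Fin 3) (Fin 3) ℝ) (F N : E2 → E3) : Prop :=
  IsNondegenerate D G F N ∧
    ∃ (ε : ℝ) (γ : ℝ → E2), IsSingularCurve D F ε γ ∧
      ∀ w : E2, w ≠ 0 → fderiv ℝ F 0 w = 0 → LinearIndependent ℝ ![deriv γ 0, w]

/-- An extended null vector field, defined on the neighborhood `V` of the origin, such that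
`{γ', η}` is a positively oriented frame along `γ`. -/
structure IsExtendedNullField (D : Set E2) (F : E2 → E3) (ε : ℝ) (γ : ℝ → E2)
    (V : Set E2) (η : E2 → E2) : Prop where
  isOpen : IsOpen V
  zero_mem : (0 : E2) ∈ V
  subset : V ⊆ D
  smooth : ContDiffOn ℝ ∞ η V
  ne_zero : ∀ x ∈ V, η x ≠ 0
  null : ∀ t ∈ Set.Ioo (-ε) ε, γ t ∈ V → fderiv ℝ F (γ t) (η (γ t)) = 0
  positive : ∀ t ∈ Set.Ioo (-ε) ε, γ t ∈ V →
    0 < Matrix.det (Matrix.of ![(deriv γ t).ofLp, (η (γ t)).ofLp])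

/-- `f_η`, `f_{ηη}` and `f_{ηηη}`. -/
def fEta (F : E2 → E3) (η : E2 → E2) : E2 → E3 := fun x => fderiv ℝ F x (η x)
def fEta2 (G : E3 → Matrix (Fin 3) (Fin 3) ℝ) (F : E2 → E3) (η : E2 → E2) : E2 → E3 :=
  covDeriv G F η (fEta F η)
def fEta3 (G : E3 → Matrix (Fin 3) (Fin 3) ℝ) (F : E2 → E3) (η : E2 → E2) : E2 → E3 :=
  covDeriv G F η (fEta2 G F η)

/-- The speed of the image `f ∘ γ` of the singular curve. -/
def speed (G : E3 → Matrix (Fin 3) (Fin 3) ℝ) (F : E2 → E3) (γ : ℝ → E2) (t : ℝ) : ℝ :=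
  len G (F (γ t)) (deriv (F ∘ γ) t)

/-- The cuspidal curvature along the singular curve `γ`. -/
def cuspidalCurvature (G : E3 → Matrix (Fin 3) (Fin 3) ℝ) (F : E2 → E3) (γ : ℝ → E2)
    (η : E2 → E2) (t : ℝ) : ℝ :=
  speed G F γ t ^ (3 / 2 : ℝ) *
      detg G (F (γ t)) (deriv (F ∘ γ) t) (fEta2 G F η (γ t)) (fEta3 G F η (γ t)) /
    len G (F (γ t)) (crossg G (F (γ t)) (deriv (F ∘ γ) t) (fEta2 G F η (γ t))) ^ (5 / 2 : ℝ)

/-- The derivate cuspidal curvature at `γ 0`: the derivative of the cuspidal curvature with respect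
to the arclength `s` of `f ∘ γ`, written in an arbitrary parameter by `ds/dt = |(f ∘ γ)'|`. -/
def derivateCuspidalCurvature (G : E3 → Matrix (Fin 3) (Fin 3) ℝ) (F : E2 → E3) (γ : ℝ → E2)
    (η : E2 → E2) : ℝ :=
  deriv (cuspidalCurvature G F γ η) 0 / speed G F γ 0

/-! ### Blow-up of the plane, rational boundedness and rational continuity -/

/-- The identification `(r, θ) ∼ (-r, θ + π)` (hence also `(r, θ) ∼ (r, θ + 2π)`). -/
def blowUpSetoid : Setoid (ℝ × ℝ) where
  r a b := ∃ n : ℤ, b.1 = (n.negOnePow : ℤ) * a.1 ∧ b.2 = a.2 + n * Real.pi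
  iseqv := by
    refine ⟨fun a => ⟨0, by simp, by simp⟩, ?_, ?_⟩
    · rintro a b ⟨n, h1, h2⟩
      refine ⟨-n, ?_, ?_⟩
      · rw [h1, Int.negOnePow_neg, ← mul_assoc]
        norm_cast
        rw [Int.units_mul_self]
        simp
      · rw [h2]; push_cast; ring
    · rintro a b c ⟨n, h1, h2⟩ ⟨m, h3, h4⟩
      refine ⟨m + n, ?_, ?_⟩
      · rw [h3, h1, Int.negOnePow_add]; push_cast; ring
      · rw [h4, h2]; push_cast; ring

/-- The blow-up of the plane at the origin (an open Möbius band). -/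
def BlowUp : Type := Quotient blowUpSetoid

/-- The covering map `(r, θ) ↦ [(r, θ)]`. -/
def BlowUp.mk (a : ℝ × ℝ) : BlowUp := Quotient.mk blowUpSetoid a

/-- The projection of the blow-up to the plane, `[(r, θ)] ↦ (r cos θ, r sin θ)`. -/
def BlowUp.proj : BlowUp → E2 :=
  Quotient.lift (fun a : ℝ × ℝ => !₂[a.1 * Real.cos a.2, a.1 * Real.sin a.2]) (by
    rintro a b ⟨n, h1, h2⟩
    have hs : ((n.negOnePow : ℤ) : ℝ) = (-1) ^ n := by
      rcases Int.even_or_odd n with h | h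
      · simp [Int.negOnePow_even n h, h.neg_one_zpow]
      · simp [Int.negOnePow_odd n h, h.neg_one_zpow]
    have hq : ((-1 : ℝ) ^ n) * (-1) ^ n = 1 := by
      rw [← mul_zpow]; simp
    show !₂[a.1 * Real.cos a.2, a.1 * Real.sin a.2] = !₂[b.1 * Real.cos b.2, b.1 * Real.sin b.2]
    have key : ∀ x : ℝ, (-1 : ℝ) ^ n * a.1 * ((-1) ^ n * x) = a.1 * x := fun x => by
      rw [mul_mul_mul_comm, hq, one_mul]
    rw [h1, h2, hs, Real.cos_add_int_mul_pi, Real.sin_add_int_mul_pi, key, key])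

/-- A function on the blow-up is smooth on the part over `U`. -/
def BlowUp.SmoothOver (U : Set E2) (h : BlowUp → ℝ) : Prop :=
  ContDiffOn ℝ ∞ (fun a : ℝ × ℝ => h (BlowUp.mk a)) {a | (BlowUp.mk a).proj ∈ U}

/-- The functions `lam` and `psi` on the blow-up over `U` exhibit the smooth function `φ` on the open
dense subset `O` of `U` as rationally bounded at the origin. -/
structure IsRationalPair (U O : Set E2) (φ : E2 → ℝ) (lam psi : BlowUp → ℝ) : Prop where
  isOpen : IsOpen U
  zero_mem : (0 : E2) ∈ U
  isOpen_dom : IsOpen O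
  subset : O ⊆ U
  dense : U ⊆ closure O
  smooth : ContDiffOn ℝ ∞ φ O
  smooth_lam : BlowUp.SmoothOver U lam
  smooth_psi : BlowUp.SmoothOver U psi
  zero_set : BlowUp.proj ⁻¹' (O \ {0}) = BlowUp.proj ⁻¹' (U \ {0}) ∩ {q | lam q ≠ 0}
  finite : {q : BlowUp | lam q = 0 ∧ q.proj = 0}.Finite
  eq : ∀ q : BlowUp, q.proj ∈ O → psi q = lam q * φ q.proj

/-- `φ`, defined on the set `R ⊆ D`, is rationally bounded at the origin. -/
def RationallyBounded (D R : Set E2) (φ : E2 → ℝ) : Prop :=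
  ∃ U : Set E2, U ⊆ D ∧ ∃ lam psi : BlowUp → ℝ, IsRationalPair U (U ∩ R) φ lam psi

/-- `φ`, defined on the set `R ⊆ D`, is rationally continuous at the origin. -/
def RationallyContinuous (D R : Set E2) (φ : E2 → ℝ) : Prop :=
  ∃ U : Set E2, U ⊆ D ∧ ∃ lam psi : BlowUp → ℝ, IsRationalPair U (U ∩ R) φ lam psi ∧
    ∃ c : ℝ, ∀ q : BlowUp, q.proj = 0 → psi q = c * lam q

/-- `φ`, defined on the set `R ⊆ D`, is bounded near the origin. -/
def BoundedNear (D R : Set E2) (φ : E2 → ℝ) : Prop :=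
  ∃ U : Set E2, IsOpen U ∧ (0 : E2) ∈ U ∧ U ⊆ D ∧ ∃ C : ℝ, ∀ x ∈ U ∩ R, |φ x| ≤ C

end FrontalGeometry

end

noncomputable section

namespace FrontalGeometry

open Set Filter

/-! ### Hadamard's lemma for smooth maps. -/

section Hadamard

universe u
variable {E : Type u} [NormedAddCommGroup E] [NormedSpace ℝ E] [FiniteDimensional ℝ E]

/-! Write the mean curvature as `H = num / (2 λ²)`, where `λ` is the signed area density and `num`
the usual combination of the two fundamental forms. At a non-degenerate singular point `λ` has a
regular zero. Passing to another frame multiplies `num` by the square of a determinant, and in a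
frame containing a null vector every term of `num` vanishes; hence `num = 0` wherever `λ = 0`.

Everything is then decided by `q(t) = d num(η)` along the singular curve `γ`, because `η` is
transversal to `γ` and `num` already vanishes on `γ`. First, `H` is bounded iff `num = O(λ²)`, i.e.
iff `d num` vanishes along `γ` near the point, i.e. `q ≡ 0` (`boundedNear_iff`). Second, along rays
`x = r v` Hadamard's lemma gives `λ = r L_x(v)` and, once `d num` vanishes at the origin, `num = r²
B_x(v, v)`. So `2 L_x(v)²` and `B_x(v, v)` form a rational pair; conversely, letting `r → 0` in the
cleared identity forces `d num = 0` at the origin. This is the condition `q(0) = 0`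
(`rationallyBounded_iff`). Third, a constant ratio on the exceptional fiber means that the quadratic
form `B₀` is a multiple of `dλ²`. As `dλ(γ') = 0` and `B₀(γ', γ') = 0`, only the mixed term `B₀(γ',
η) + B₀(η, γ') = q'(0)` has to vanish (`rationallyContinuous_iff`).

It remains to see that `κ_c = K q` with `K` continuous and nonzero (`cuspidalCurvature_eq`). Along
`γ` both `f∘γ'` and `f_ηη` are orthogonal to `ν`, so `det(f∘γ', f_ηη, f_ηηη) = det(f∘γ', f_ηη, ν)
⟨ν, f_ηηη⟩`. The first factor is a nonzero multiple of `dλ(η)`, and also gives the length of the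
vector product up to sign. The second is `-2⟨f_ηη, ∇_η ν⟩`, which is a nonzero multiple of `q`. At a
zero of `q` one has `κ_c' = K q'`, so the conditions on `q` become those on `κ_c`. -/

lemma hasFDerivAt_intervalIntegral_param {G : Type*} [NormedAddCommGroup G] [NormedSpace ℝ G]
    {f : E × ℝ → G} (hf : ContDiff ℝ ∞ f) (x₀ : E) :
    HasFDerivAt (fun x => ∫ t in (0 : ℝ)..1, f (x, t))
      (∫ t in (0 : ℝ)..1, (fderiv ℝ f (x₀, t)).comp (ContinuousLinearMap.inl ℝ E ℝ)) x₀ := by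
  have hc := hf.continuous
  have hF' : Continuous fun a : E × ℝ =>
      (fderiv ℝ f a).comp (ContinuousLinearMap.inl ℝ E ℝ) :=
    (hf.continuous_fderiv (by simp)).clm_comp continuous_const
  -- The dominating function is a constant, the bound of the continuous derivative on a compact set.
  obtain ⟨C, hC⟩ := ((isCompact_closedBall x₀ 1).prod
    (isCompact_Icc (a := (0 : ℝ)) (b := 1))).exists_bound_of_continuousOn hF'.continuousOn
  refine intervalIntegral.hasFDerivAt_integral_of_dominated_of_fderiv_le
    (F := fun x t => f (x, t))
    (F' := fun x t => (fderiv ℝ f (x, t)).comp (ContinuousLinearMap.inl ℝ E ℝ))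
    (s := Metric.closedBall x₀ 1) (bound := fun _ => C)
    (Metric.closedBall_mem_nhds x₀ one_pos) (Eventually.of_forall fun x => ?_) ?_ ?_ ?_ ?_ ?_
  · exact (hc.comp (by fun_prop : Continuous fun t : ℝ => (x, t))).aestronglyMeasurable
  · exact (hc.comp (by fun_prop : Continuous fun t : ℝ => (x₀, t))).intervalIntegrable _ _
  · exact (hF'.comp (by fun_prop : Continuous fun t : ℝ => (x₀, t))).aestronglyMeasurable
  · refine Eventually.of_forall fun t ht x hx => hC (x, t) ⟨hx, ?_⟩
    rw [uIoc_of_le zero_le_one] at ht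
    exact ⟨ht.1.le, ht.2⟩
  · exact intervalIntegrable_const
  · refine Eventually.of_forall fun t _ x _ => ?_
    have h1 : HasFDerivAt (fun x : E => (x, t)) (ContinuousLinearMap.inl ℝ E ℝ) x :=
      hasFDerivAt_prodMk_left x t
    exact ((hf.differentiable (by simp)) (x, t)).hasFDerivAt.comp x h1

/-- Smooth dependence of an integral on parameters. -/
lemma contDiff_intervalIntegral_param {G : Type u} [NormedAddCommGroup G] [NormedSpace ℝ G]
    {f : E × ℝ → G} (hf : ContDiff ℝ ∞ f) :
    ContDiff ℝ ∞ (fun x => ∫ t in (0 : ℝ)..1, f (x, t)) := by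
  rw [contDiff_infty]
  intro n
  -- The derivative takes values in `E →L[ℝ] G`, so the target changes at each step; sharing the
  -- universe `u` keeps it within the induction hypothesis.
  induction n generalizing G with
  | zero =>
    refine contDiff_zero.2 ?_
    exact intervalIntegral.continuous_parametric_intervalIntegral_of_continuous'
      (f := fun x t => f (x, t)) hf.continuous 0 1
  | succ n ih =>
    push_cast
    rw [contDiff_succ_iff_hasFDerivAt]
    refine ⟨_, ?_, fun x => hasFDerivAt_intervalIntegral_param hf x⟩
    refine ih (f := fun a => (fderiv ℝ f a).comp (ContinuousLinearMap.inl ℝ E ℝ)) ?_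
    exact (hf.fderiv_right (m := ∞) (by simp)).clm_comp contDiff_const

/-- Hadamard's lemma. -/
lemma exists_contDiff_clm_apply_self {G : Type u} [NormedAddCommGroup G] [NormedSpace ℝ G]
    [CompleteSpace G] {f : E → G} (hf : ContDiff ℝ ∞ f) (h0 : f 0 = 0) :
    ∃ A : E → E →L[ℝ] G, ContDiff ℝ ∞ A ∧ A 0 = fderiv ℝ f 0 ∧ ∀ x, f x = A x x := by
  have hf' : ContDiff ℝ ∞ (fderiv ℝ f) := hf.fderiv_right (m := ∞) (by simp)
  refine ⟨fun x => ∫ t in (0 : ℝ)..1, fderiv ℝ f (t • x), ?_, by simp, fun x => ?_⟩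
  · exact contDiff_intervalIntegral_param (f := fun a : E × ℝ => fderiv ℝ f (a.2 • a.1))
      (hf'.comp (contDiff_snd.smul contDiff_fst))
  · have hc : Continuous fun t : ℝ => fderiv ℝ f (t • x) :=
      hf'.continuous.comp (by fun_prop)
    rw [ContinuousLinearMap.intervalIntegral_apply (hc.intervalIntegrable _ _)]
    have hd : ∀ t ∈ uIcc (0 : ℝ) 1, HasDerivAt (fun t : ℝ => f (t • x)) (fderiv ℝ f (t • x) x) t := by
      intro t _
      have h1 : HasDerivAt (fun t : ℝ => t • x) ((1 : ℝ) • x) t := (hasDerivAt_id t).smul_const x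
      rw [one_smul] at h1
      exact ((hf.differentiable (by simp)) (t • x)).hasFDerivAt.comp_hasDerivAt t h1
    rw [intervalIntegral.integral_eq_sub_of_hasDerivAt hd
      ((hc.clm_apply continuous_const).intervalIntegrable _ _)]
    simp [h0]

end Hadamard

/-- Multiplication by a bump function. Hadamard's lemma integrates over whole segments and is stated
for globally smooth maps, while the geometric data are smooth only on an open set. -/
lemma exists_contDiff_eventuallyEq {E G : Type*} [NormedAddCommGroup E]
    [NormedSpace ℝ E] [NormedAddCommGroup G] [NormedSpace ℝ G] [HasContDiffBump E]
    {f : E → G} {D : Set E} (hD : IsOpen D) (h0 : (0 : E) ∈ D)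
    (hf : ContDiffOn ℝ ∞ f D) :
    ∃ f' : E → G, ContDiff ℝ ∞ f' ∧ f' =ᶠ[𝓝 0] f := by
  obtain ⟨r, hr, hrD⟩ := Metric.isOpen_iff.1 hD 0 h0
  let χ : ContDiffBump (0 : E) := ⟨r / 4, r / 2, by positivity, by linarith⟩
  refine ⟨fun x => χ x • f x,
    contMDiff_iff_contDiff.1 (contMDiff_of_tsupport fun x hx => contMDiffAt_iff_contDiffAt.2 ?_), ?_⟩
  · have hx' : x ∈ tsupport χ := tsupport_smul_subset_left _ _ hx
    rw [χ.tsupport_eq] at hx'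
    have hxD : x ∈ D := hrD (Metric.closedBall_subset_ball (by simp [χ]; linarith) hx')
    exact χ.contDiff.contDiffAt.smul (hf.contDiffAt (hD.mem_nhds hxD))
  · filter_upwards [χ.eventuallyEq_one] with x hx
    simp [hx]

/-! ### Functions on the blow-up -/

/-- The unit vector with polar angle `θ`. -/
def dir (θ : ℝ) : E2 := !₂[Real.cos θ, Real.sin θ]

lemma contDiff_dir : ContDiff ℝ ∞ dir := by
  rw [contDiff_euclidean]
  intro i
  fin_cases i
  · exact Real.contDiff_cos
  · exact Real.contDiff_sin

lemma BlowUp.proj_mk (r θ : ℝ) : (BlowUp.mk (r, θ)).proj = r • dir θ := by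
  ext i
  fin_cases i <;> simp [BlowUp.proj, BlowUp.mk, dir]

lemma dir_ne_zero (θ : ℝ) : dir θ ≠ 0 := by
  intro h
  have h0 : Real.cos θ = 0 := congrArg (fun v : E2 => v 0) h
  have h1 : Real.sin θ = 0 := congrArg (fun v : E2 => v 1) h
  have := Real.sin_sq_add_cos_sq θ
  simp [h0, h1] at this

lemma dir_add_int_mul_pi (θ : ℝ) (n : ℤ) : dir (θ + n * Real.pi) = ((-1 : ℝ) ^ n) • dir θ := by
  ext i
  fin_cases i <;> simp [dir, Real.cos_add_int_mul_pi, Real.sin_add_int_mul_pi]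

lemma exists_eq_smul_dir (x : E2) : ∃ r θ : ℝ, x = r • dir θ := by
  refine ⟨‖(⟨x 0, x 1⟩ : ℂ)‖, Complex.arg ⟨x 0, x 1⟩, ?_⟩
  ext i
  fin_cases i
  · simp [dir]
  · simp [dir]

lemma BlowUp.mk_eq_mk_add_int_mul_pi (θ : ℝ) (n : ℤ) :
    BlowUp.mk (0, θ + n * Real.pi) = BlowUp.mk (0, θ) :=
  (Quotient.sound (s := blowUpSetoid) ⟨n, by simp, by simp⟩ : BlowUp.mk (0, θ) = _).symm

lemma BlowUp.mk_zero_eq_of_sin_sub_eq_zero {θ θ' : ℝ} (h : Real.sin (θ' - θ) = 0) :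
    BlowUp.mk (0, θ') = BlowUp.mk (0, θ) := by
  obtain ⟨n, hn⟩ := Real.sin_eq_zero_iff.1 h
  rw [← BlowUp.mk_eq_mk_add_int_mul_pi θ n, hn, add_sub_cancel]

/-- The function on the blow-up defined by a function that is even in the direction. -/
def BlowUp.ofEven (k : E2 → E2 → ℝ) (hk : ∀ x v, k x (-v) = k x v) : BlowUp → ℝ :=
  Quotient.lift (fun a : ℝ × ℝ => k (a.1 • dir a.2) (dir a.2)) (by
    rintro ⟨r, θ⟩ ⟨r', θ'⟩ ⟨n, h1, h2⟩
    dsimp only at h1 h2 ⊢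
    rw [h2, dir_add_int_mul_pi, h1]
    rcases Int.even_or_odd n with h | h
    · simp [Int.negOnePow_even n h, h.neg_one_zpow]
    · simp [Int.negOnePow_odd n h, h.neg_one_zpow, hk])

@[simp] lemma BlowUp.ofEven_mk (k : E2 → E2 → ℝ) (hk : ∀ x v, k x (-v) = k x v) (r θ : ℝ) :
    BlowUp.ofEven k hk (BlowUp.mk (r, θ)) = k (r • dir θ) (dir θ) := rfl

lemma BlowUp.exists_mk (q : BlowUp) : ∃ r θ : ℝ, q = BlowUp.mk (r, θ) := by
  induction q using Quotient.inductionOn with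
  | h a => exact ⟨a.1, a.2, rfl⟩

lemma BlowUp.proj_mk_eq_zero {r θ : ℝ} : (BlowUp.mk (r, θ)).proj = 0 ↔ r = 0 := by
  rw [BlowUp.proj_mk, smul_eq_zero, or_iff_left (dir_ne_zero θ)]

lemma clm_apply_dir (l : E2 →L[ℝ] ℝ) (θ : ℝ) :
    l (dir θ) = Real.cos θ * l du + Real.sin θ * l dv := by
  have : dir θ = Real.cos θ • du + Real.sin θ • dv := by
    ext i
    fin_cases i <;> simp [dir, du, dv]
  rw [this]
  simp

/-- The kernel of a nonzero functional on the plane is a line, so the two directions are parallel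
and give one point of the exceptional fiber. -/
lemma sin_sub_eq_zero_of_clm_apply_dir {l : E2 →L[ℝ] ℝ} (hl : l ≠ 0) {θ θ' : ℝ}
    (h : l (dir θ) = 0) (h' : l (dir θ') = 0) : Real.sin (θ' - θ) = 0 := by
  rw [clm_apply_dir] at h h'
  rw [Real.sin_sub]
  by_contra hs
  have hu : l du = 0 := by
    have : (Real.sin θ' * Real.cos θ - Real.cos θ' * Real.sin θ) * l du = 0 := by
      linear_combination Real.sin θ' * h - Real.sin θ * h'
    exact (mul_eq_zero.1 this).resolve_left hs
  have hv : l dv = 0 := by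
    have : (Real.sin θ' * Real.cos θ - Real.cos θ' * Real.sin θ) * l dv = 0 := by
      linear_combination Real.cos θ * h' - Real.cos θ' * h
    exact (mul_eq_zero.1 this).resolve_left hs
  apply hl
  ext x
  obtain ⟨r, φ, rfl⟩ := exists_eq_smul_dir x
  rw [map_smul, clm_apply_dir, hu, hv]
  simp

/-- An identity between continuous functions of the direction that holds wherever a function
with finitely many zeros on the exceptional fiber does not vanish holds everywhere. -/
lemma forall_dir_of_ne_zero {lam : BlowUp → ℝ}
    (hfin : {q : BlowUp | lam q = 0 ∧ q.proj = 0}.Finite) {k k' : ℝ → ℝ} (hk : Continuous k)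
    (hk' : Continuous k') (h : ∀ θ, lam (BlowUp.mk (0, θ)) ≠ 0 → k θ = k' θ) (θ : ℝ) :
    k θ = k' θ := by
  set Z : Set ℝ := {θ | lam (BlowUp.mk (0, θ)) = 0}
  -- A point of the exceptional fiber has only the angles `θ₀ + nπ` above it, so the excluded angles
  -- are countable and their complement is dense.
  have hZ : Z.Countable := by
    have hsub : Z ⊆ ⋃ q ∈ {q : BlowUp | lam q = 0 ∧ q.proj = 0}, {θ | BlowUp.mk (0, θ) = q} := by
      intro θ hθ
      simp only [mem_iUnion]
      exact ⟨BlowUp.mk (0, θ), ⟨hθ, BlowUp.proj_mk_eq_zero.2 rfl⟩, rfl⟩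
    refine (hfin.countable.biUnion fun q _ => ?_).mono hsub
    by_cases hne : ∃ θ₀, BlowUp.mk (0, θ₀) = q
    · obtain ⟨θ₀, rfl⟩ := hne
      refine (countable_range fun n : ℤ => θ₀ + n * Real.pi).mono ?_
      intro θ hθ
      obtain ⟨n, -, hn⟩ := Quotient.exact (s := blowUpSetoid) (hθ : BlowUp.mk (0, θ) = _).symm
      exact ⟨n, hn.symm⟩
    · refine countable_empty.mono fun θ hθ => hne ⟨θ, hθ⟩
  have hd : Dense Zᶜ := hZ.dense_compl ℝ
  exact congrFun (hk.ext_on hd hk' fun θ hθ => h θ hθ) θ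

/-! ### Quotients by the square of a function with a regular zero -/

lemma exists_eventually_eq_clm_apply_self {f : E2 → ℝ} {D : Set E2} (hD : IsOpen D)
    (h0 : (0 : E2) ∈ D) (hf : ContDiffOn ℝ ∞ f D) (hf0 : f 0 = 0) :
    ∃ A : E2 → E2 →L[ℝ] ℝ, ContDiff ℝ ∞ A ∧ A 0 = fderiv ℝ f 0 ∧ ∀ᶠ x in 𝓝 0, f x = A x x := by
  obtain ⟨f', hf', he⟩ := exists_contDiff_eventuallyEq hD h0 hf
  obtain ⟨A, hA, hA0, hAx⟩ := exists_contDiff_clm_apply_self hf' (he.eq_of_nhds.trans hf0)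
  refine ⟨A, hA, hA0.trans he.fderiv_eq, ?_⟩
  filter_upwards [he] with x hx
  rw [← hx, hAx]

lemma exists_eventually_eq_clm_apply_self_self {f : E2 → ℝ} {D : Set E2} (hD : IsOpen D)
    (h0 : (0 : E2) ∈ D) (hf : ContDiffOn ℝ ∞ f D) (hf0 : f 0 = 0) (hf1 : fderiv ℝ f 0 = 0) :
    ∃ B : E2 → E2 →L[ℝ] E2 →L[ℝ] ℝ, ContDiff ℝ ∞ B ∧ ∀ᶠ x in 𝓝 0, f x = B x x x := by
  obtain ⟨A, hA, hA0, hAx⟩ := exists_eventually_eq_clm_apply_self hD h0 hf hf0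
  obtain ⟨B, hB, -, hBx⟩ := exists_contDiff_clm_apply_self hA (hA0.trans hf1)
  refine ⟨B, hB, ?_⟩
  filter_upwards [hAx] with x hx
  rw [hx, hBx]

/-- The function `H` is, on `D`, the quotient of `num`, which vanishes with `lam`, by `2 * lam ^ 2`,
and `lam` has a regular zero at the origin. -/
structure IsSquareQuotient (D : Set E2) (lam num H : E2 → ℝ) : Prop where
  isOpen : IsOpen D
  zero_mem : (0 : E2) ∈ D
  smooth_lam : ContDiffOn ℝ ∞ lam D
  smooth_num : ContDiffOn ℝ ∞ num D
  lam_zero : lam 0 = 0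
  fderiv_ne : fderiv ℝ lam 0 ≠ 0
  num_zero : ∀ x ∈ D, lam x = 0 → num x = 0
  eq : ∀ x ∈ D, lam x ≠ 0 → H x = num x / (2 * lam x ^ 2)

variable {D : Set E2} {lam num H : E2 → ℝ}

lemma tendsto_smul_dir (θ : ℝ) : Tendsto (fun r : ℝ => r • dir θ) (𝓝 0) (𝓝 0) := by
  have : Continuous fun r : ℝ => r • dir θ := by fun_prop
  simpa using this.tendsto 0

lemma BlowUp.SmoothOver.tendsto {U : Set E2} (hU : IsOpen U) (h0 : (0 : E2) ∈ U) {h : BlowUp → ℝ}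
    (hh : BlowUp.SmoothOver U h) (θ : ℝ) :
    Tendsto (fun r => h (BlowUp.mk (r, θ))) (𝓝 0) (𝓝 (h (BlowUp.mk (0, θ)))) := by
  have hop : IsOpen {a : ℝ × ℝ | (BlowUp.mk a).proj ∈ U} := by
    have : Continuous fun a : ℝ × ℝ => a.1 • dir a.2 :=
      continuous_fst.smul (contDiff_dir.continuous.comp continuous_snd)
    convert hU.preimage this using 1
    ext ⟨r, θ⟩
    simp only [mem_ofPred_eq, mem_preimage, BlowUp.proj_mk]
  have hmem : ((0 : ℝ), θ) ∈ {a : ℝ × ℝ | (BlowUp.mk a).proj ∈ U} := by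
    simpa [BlowUp.proj_mk] using h0
  have hc := (hh.contDiffAt (hop.mem_nhds hmem)).continuousAt
  have hr : Continuous fun r : ℝ => ((r, θ) : ℝ × ℝ) := by fun_prop
  exact Tendsto.comp (f := fun r : ℝ => ((r, θ) : ℝ × ℝ)) hc (hr.tendsto 0)

/-! ### Limits along rays, and the explicit rational pair. -/

namespace IsSquareQuotient

lemma num_at_zero (h : IsSquareQuotient D lam num H) : num 0 = 0 :=
  h.num_zero 0 h.zero_mem h.lam_zero

/-- Clearing denominators makes the defining relation hold on the zero set of `lam` too, since `num`
vanishes there. It can therefore be used along every ray, even one lying in that zero set. -/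
lemma eventually_rational_identity (h : IsSquareQuotient D lam num H) {U : Set E2} (hUD : U ⊆ D)
    {Lam psi : BlowUp → ℝ} (hp : IsRationalPair U (U ∩ {x | x ∈ D ∧ lam x ≠ 0}) H Lam psi) (θ : ℝ) :
    ∀ᶠ r : ℝ in 𝓝 0, 2 * psi (BlowUp.mk (r, θ)) * lam (r • dir θ) ^ 2 =
      Lam (BlowUp.mk (r, θ)) * num (r • dir θ) := by
  filter_upwards [(tendsto_smul_dir θ).eventually (hp.isOpen.mem_nhds hp.zero_mem)] with r hr
  by_cases hl : lam (r • dir θ) = 0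
  · rw [hl, h.num_zero _ (hUD hr) hl]
    ring
  · have := hp.eq (BlowUp.mk (r, θ)) (by rw [BlowUp.proj_mk]; exact ⟨hr, hUD hr, hl⟩)
    rw [this, BlowUp.proj_mk, h.eq _ (hUD hr) hl]
    field_simp

/-- Divide the cleared identity by `r` and let `r → 0`: the left side still contains a factor `r`,
the right side tends to `Lam · d num(dir θ)`. -/
lemma fderiv_num_eq_zero_of_rationallyBounded (h : IsSquareQuotient D lam num H)
    (hb : RationallyBounded D {x | x ∈ D ∧ lam x ≠ 0} H) : fderiv ℝ num 0 = 0 := by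
  obtain ⟨U, hUD, Lam, psi, hp⟩ := hb
  obtain ⟨L, hL, hL0, hLx⟩ :=
    exists_eventually_eq_clm_apply_self h.isOpen h.zero_mem h.smooth_lam h.lam_zero
  obtain ⟨A, hA, hA0, hAx⟩ :=
    exists_eventually_eq_clm_apply_self h.isOpen h.zero_mem h.smooth_num h.num_at_zero
  have key : ∀ θ, Lam (BlowUp.mk (0, θ)) ≠ 0 → fderiv ℝ num 0 (dir θ) = 0 := by
    intro θ hθ
    have e1 : (fun r : ℝ => 2 * psi (BlowUp.mk (r, θ)) * r * (L (r • dir θ) (dir θ)) ^ 2) =ᶠ[𝓝[≠] 0]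
        fun r => Lam (BlowUp.mk (r, θ)) * A (r • dir θ) (dir θ) := by
      have := (h.eventually_rational_identity hUD hp θ).and
        (((tendsto_smul_dir θ).eventually hLx).and ((tendsto_smul_dir θ).eventually hAx))
      filter_upwards [this.filter_mono nhdsWithin_le_nhds, self_mem_nhdsWithin]
        with r ⟨h1, h2, h3⟩ hr
      rw [h2, h3, map_smul, map_smul, smul_eq_mul, smul_eq_mul] at h1
      apply mul_left_cancel₀ (hr : r ≠ 0)
      linear_combination h1
    have c1 : Continuous fun r : ℝ => L (r • dir θ) (dir θ) := by
      have := hL.continuous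
      fun_prop
    have c2 : Continuous fun r : ℝ => A (r • dir θ) (dir θ) := by
      have := hA.continuous
      fun_prop
    have t1 := (((hp.smooth_psi.tendsto hp.isOpen hp.zero_mem θ).const_mul 2).mul
      tendsto_id).mul ((c1.tendsto 0).pow 2)
    have t2 := (hp.smooth_lam.tendsto hp.isOpen hp.zero_mem θ).mul (c2.tendsto 0)
    have := tendsto_nhds_unique ((t1.mono_left nhdsWithin_le_nhds).congr' e1)
      (t2.mono_left nhdsWithin_le_nhds)
    simp only [mul_zero, zero_mul, zero_smul, hA0] at this
    exact (mul_eq_zero.1 this.symm).resolve_left hθ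
  have key' : ∀ θ, fderiv ℝ num 0 (dir θ) = 0 :=
    forall_dir_of_ne_zero hp.finite
      ((fderiv ℝ num 0).continuous.comp contDiff_dir.continuous) continuous_const key
  ext x
  obtain ⟨r, θ, rfl⟩ := exists_eq_smul_dir x
  simp [key']

/-- Here both sides of the cleared identity are divisible by `r²`, and on the exceptional fiber `psi
= c Lam`; cancelling `Lam` compares the two quadratic forms. -/
lemma exists_quadratic_eq_of_rationallyContinuous (h : IsSquareQuotient D lam num H)
    (hb : RationallyContinuous D {x | x ∈ D ∧ lam x ≠ 0} H)
    {B : E2 → E2 →L[ℝ] E2 →L[ℝ] ℝ} (hB : ContDiff ℝ ∞ B) (hBx : ∀ᶠ x in 𝓝 0, num x = B x x x) :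
    ∃ c : ℝ, ∀ x, B 0 x x = c * fderiv ℝ lam 0 x ^ 2 := by
  obtain ⟨U, hUD, Lam, psi, hp, c, hc⟩ := hb
  obtain ⟨L, hL, hL0, hLx⟩ :=
    exists_eventually_eq_clm_apply_self h.isOpen h.zero_mem h.smooth_lam h.lam_zero
  have key : ∀ θ, Lam (BlowUp.mk (0, θ)) ≠ 0 →
      B 0 (dir θ) (dir θ) = 2 * c * fderiv ℝ lam 0 (dir θ) ^ 2 := by
    intro θ hθ
    have e1 : (fun r : ℝ => 2 * psi (BlowUp.mk (r, θ)) * (L (r • dir θ) (dir θ)) ^ 2) =ᶠ[𝓝[≠] 0]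
        fun r => Lam (BlowUp.mk (r, θ)) * B (r • dir θ) (dir θ) (dir θ) := by
      have := (h.eventually_rational_identity hUD hp θ).and
        (((tendsto_smul_dir θ).eventually hLx).and ((tendsto_smul_dir θ).eventually hBx))
      filter_upwards [this.filter_mono nhdsWithin_le_nhds, self_mem_nhdsWithin]
        with r ⟨h1, h2, h3⟩ hr
      rw [h2, h3, map_smul, map_smul, map_smul, smul_apply, smul_eq_mul,
        smul_eq_mul, smul_eq_mul] at h1
      apply mul_left_cancel₀ (pow_ne_zero 2 (hr : r ≠ 0))
      linear_combination h1
    have c1 : Continuous fun r : ℝ => L (r • dir θ) (dir θ) := by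
      have := hL.continuous
      fun_prop
    have c2 : Continuous fun r : ℝ => B (r • dir θ) (dir θ) (dir θ) := by
      have := hB.continuous
      fun_prop
    have t1 := ((hp.smooth_psi.tendsto hp.isOpen hp.zero_mem θ).const_mul 2).mul
      ((c1.tendsto 0).pow 2)
    have t2 := (hp.smooth_lam.tendsto hp.isOpen hp.zero_mem θ).mul (c2.tendsto 0)
    have := tendsto_nhds_unique ((t1.mono_left nhdsWithin_le_nhds).congr' e1)
      (t2.mono_left nhdsWithin_le_nhds)
    simp only [zero_smul, hL0, hc _ (BlowUp.proj_mk_eq_zero.2 rfl)] at this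
    apply mul_left_cancel₀ hθ
    linear_combination -this
  have cd := contDiff_dir.continuous
  have key' : ∀ θ, B 0 (dir θ) (dir θ) = 2 * c * fderiv ℝ lam 0 (dir θ) ^ 2 :=
    forall_dir_of_ne_zero hp.finite (by fun_prop) (by fun_prop) key
  refine ⟨2 * c, fun x => ?_⟩
  obtain ⟨r, θ, rfl⟩ := exists_eq_smul_dir x
  simp only [map_smul, smul_apply, smul_eq_mul, key']
  ring

/-- The points at which a function with nonvanishing differential does not vanish are dense. -/
lemma subset_closure_ne_zero {U : Set E2} (hU : IsOpen U) (hd : ∀ x ∈ U, fderiv ℝ lam x ≠ 0) :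
    U ⊆ closure (U ∩ {x | lam x ≠ 0}) := by
  intro x hx
  rw [mem_closure_iff_nhds]
  intro W hW
  by_contra hne
  rw [not_nonempty_iff_eq_empty] at hne
  refine hd x hx ?_
  have : lam =ᶠ[𝓝 x] fun _ => 0 := by
    filter_upwards [hW, hU.mem_nhds hx] with y hy hyU
    by_contra hy0
    exact (hne.subset ⟨hy, hyU, hy0⟩ : y ∈ (∅ : Set E2))
  rw [this.fderiv_eq]
  simp

/-- On `x = r v` the factor `r²` cancels in `num / (2 lam²)`, leaving `B x v v / (2 (L x v)²)`.
Numerator and denominator are even in `v`, so they descend to the blow-up and are smooth across the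
exceptional fiber. -/
lemma exists_isRationalPair (h : IsSquareQuotient D lam num H)
    {B : E2 → E2 →L[ℝ] E2 →L[ℝ] ℝ} (hB : ContDiff ℝ ∞ B) (hBx : ∀ᶠ x in 𝓝 0, num x = B x x x) :
    ∃ U : Set E2, U ⊆ D ∧ ∃ Lam psi : BlowUp → ℝ,
      IsRationalPair U (U ∩ {x | x ∈ D ∧ lam x ≠ 0}) H Lam psi ∧
      ∀ θ, Lam (BlowUp.mk (0, θ)) = 2 * fderiv ℝ lam 0 (dir θ) ^ 2 ∧
        psi (BlowUp.mk (0, θ)) = B 0 (dir θ) (dir θ) := by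
  obtain ⟨L, hL, hL0, hLx⟩ :=
    exists_eventually_eq_clm_apply_self h.isOpen h.zero_mem h.smooth_lam h.lam_zero
  have hdc : ∀ᶠ x in 𝓝 0, fderiv ℝ lam x ≠ 0 :=
    ((h.smooth_lam.contDiffAt (h.isOpen.mem_nhds h.zero_mem)).fderiv_right
      (m := 0) (by simp)).continuousAt.eventually_ne h.fderiv_ne
  obtain ⟨U, hU, hUo, hU0⟩ := eventually_nhds_iff.1
    ((h.isOpen.eventually_mem h.zero_mem).and (hdc.and (hLx.and hBx)) :
      ∀ᶠ x in 𝓝 (0 : E2), _)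
  have hUD : U ⊆ D := fun x hx => (hU x hx).1
  have hOeq : U ∩ {x | x ∈ D ∧ lam x ≠ 0} = U ∩ {x | lam x ≠ 0} := by
    ext x
    exact ⟨fun hx => ⟨hx.1, hx.2.2⟩, fun hx => ⟨hx.1, hUD hx.1, hx.2⟩⟩
  have hpt : ContDiff ℝ ∞ fun a : ℝ × ℝ => a.1 • dir a.2 :=
    contDiff_fst.smul (contDiff_dir.comp contDiff_snd)
  have hdir : ContDiff ℝ ∞ fun a : ℝ × ℝ => dir a.2 := contDiff_dir.comp contDiff_snd
  have hlam : ∀ r θ, r • dir θ ∈ U → lam (r • dir θ) = r * L (r • dir θ) (dir θ) := by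
    intro r θ hr
    rw [(hU _ hr).2.2.1, map_smul, smul_eq_mul]
  have hnum : ∀ r θ, r • dir θ ∈ U → num (r • dir θ) = r ^ 2 * B (r • dir θ) (dir θ) (dir θ) := by
    intro r θ hr
    rw [(hU _ hr).2.2.2, map_smul, map_smul, smul_apply, smul_eq_mul,
      smul_eq_mul]
    ring
  refine ⟨U, hUD, BlowUp.ofEven (fun x v => 2 * L x v ^ 2) (by simp),
    BlowUp.ofEven (fun x v => B x v v) (by simp), ?_, fun θ => by simp [hL0]⟩
  rw [hOeq]
  refine ⟨hUo, hU0, ?_, inter_subset_left, subset_closure_ne_zero hUo fun x hx => (hU x hx).2.1,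
    ?_, ?_, ?_, ?_, ?_, ?_⟩
  · exact (h.smooth_lam.continuousOn.mono hUD).isOpen_inter_preimage hUo isOpen_ne
  · refine ContDiffOn.congr (f := fun x => num x / (2 * lam x ^ 2)) ?_
      fun x hx => h.eq x (hUD hx.1) hx.2
    refine ContDiffOn.div (h.smooth_num.mono fun x hx => hUD hx.1)
      (contDiffOn_const.mul ((h.smooth_lam.mono fun x hx => hUD hx.1).pow 2)) fun x hx => ?_
    have := hx.2
    simp only [mem_ofPred_eq] at this
    positivity
  · exact ((contDiff_const.mul (((hL.comp hpt).clm_apply hdir).pow 2)) :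
      ContDiff ℝ ∞ fun a : ℝ × ℝ => 2 * L (a.1 • dir a.2) (dir a.2) ^ 2).contDiffOn
  · exact (((hB.comp hpt).clm_apply hdir).clm_apply hdir :
      ContDiff ℝ ∞ fun a : ℝ × ℝ => B (a.1 • dir a.2) (dir a.2) (dir a.2)).contDiffOn
  · ext q
    obtain ⟨r, θ, rfl⟩ := q.exists_mk
    simp only [mem_preimage, Set.mem_sdiff, mem_inter_iff, mem_ofPred_eq, mem_singleton_iff,
      BlowUp.proj_mk_eq_zero, BlowUp.ofEven_mk]
    rw [BlowUp.proj_mk]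
    constructor
    · rintro ⟨⟨h1, h2⟩, h3⟩
      rw [hlam r θ h1] at h2
      refine ⟨⟨h1, h3⟩, ?_⟩
      have := right_ne_zero_of_mul h2
      positivity
    · rintro ⟨⟨h1, h2⟩, h3⟩
      refine ⟨⟨h1, ?_⟩, h2⟩
      rw [hlam r θ h1]
      refine mul_ne_zero h2 fun h4 => h3 (by simp [h4])
  -- On the exceptional fiber the denominator is `2 dλ(dir θ)²`, which vanishes only at the tangent
  -- direction of the zero set.
  · refine Set.Subsingleton.finite ?_
    intro q hq q' hq'
    obtain ⟨r, θ, rfl⟩ := q.exists_mk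
    obtain ⟨r', θ', rfl⟩ := q'.exists_mk
    obtain ⟨h1, h2⟩ := hq
    obtain ⟨h1', h2'⟩ := hq'
    rw [BlowUp.proj_mk_eq_zero] at h2 h2'
    subst h2 h2'
    simp only [BlowUp.ofEven_mk, zero_smul, hL0] at h1 h1'
    refine BlowUp.mk_zero_eq_of_sin_sub_eq_zero (sin_sub_eq_zero_of_clm_apply_dir h.fderiv_ne ?_ ?_)
    · simpa using h1'
    · simpa using h1
  · intro q hq
    obtain ⟨r, θ, rfl⟩ := q.exists_mk
    rw [BlowUp.proj_mk] at hq ⊢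
    obtain ⟨h1, h2⟩ := hq
    rw [h.eq _ (hUD h1) h2]
    simp only [mem_ofPred_eq] at h2
    rw [hlam r θ h1] at h2 ⊢
    rw [hnum r θ h1]
    simp only [BlowUp.ofEven_mk]
    have hr := left_ne_zero_of_mul h2
    have hL' := right_ne_zero_of_mul h2
    field_simp

end IsSquareQuotient

/-! ### Estimates of first order. -/

lemma abs_sub_le_of_hasDerivAt {k k' : ℝ → ℝ} {s C : ℝ}
    (hk : ∀ σ, |σ| ≤ |s| → HasDerivAt k (k' σ) σ) (hC : ∀ σ, |σ| ≤ |s| → |k' σ| ≤ C) :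
    |k s - k 0| ≤ C * |s| := by
  have := (convex_closedBall (0 : ℝ) |s|).norm_image_sub_le_of_norm_hasDerivWithin_le
    (f := k) (f' := k') (C := C) (x := 0) (y := s)
    (fun σ hσ => (hk σ (by simpa using hσ)).hasDerivWithinAt)
    (fun σ hσ => hC σ (by simpa using hσ)) (by simp) (by simp)
  simpa using this

lemma tendsto_clm_apply {ι X Y : Type*} [NormedAddCommGroup X] [NormedSpace ℝ X]
    [NormedAddCommGroup Y] [NormedSpace ℝ Y] {l : Filter ι} {k : ι → X →L[ℝ] Y} {v : ι → X}
    {k₀ : X →L[ℝ] Y} {v₀ : X} (hk : Tendsto k l (𝓝 k₀)) (hv : Tendsto v l (𝓝 v₀)) :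
    Tendsto (fun i => k i (v i)) l (𝓝 (k₀ v₀)) :=
  (isBoundedBilinearMap_apply.continuous.tendsto (k₀, v₀)).comp (hk.prodMk_nhds hv)

/-- One factor `lam` is `O(‖y - x‖)` and the other tends to `0`, so `num = o(‖y - x‖)`. -/
lemma fderiv_eq_zero_of_abs_le_sq {U : Set E2} (hU : IsOpen U) {x : E2} (hx : x ∈ U)
    {lam num : E2 → ℝ} (hlam : DifferentiableAt ℝ lam x) (hl : lam x = 0) {C : ℝ}
    (h : ∀ y ∈ U, |num y| ≤ C * lam y ^ 2) : fderiv ℝ num x = 0 := by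
  refine HasFDerivAt.fderiv ?_
  have hn : num x = 0 := by
    have := h x hx
    rw [hl] at this
    simpa using this
  refine hasFDerivAt_iff_isLittleO.2 ?_
  have h1 : (fun y => num y) =O[𝓝 x] fun y => lam y * lam y := by
    refine Asymptotics.IsBigO.of_bound C ?_
    filter_upwards [hU.mem_nhds hx] with y hy
    have := h y hy
    rw [Real.norm_eq_abs, Real.norm_eq_abs, abs_mul_self]
    linarith [sq (lam y)]
  have h2 : lam =O[𝓝 x] fun y => y - x := by
    simpa [hl] using hlam.hasFDerivAt.isBigO_sub
  have h3 : lam =o[𝓝 x] fun _ => (1 : ℝ) := by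
    rw [Asymptotics.isLittleO_one_iff]
    simpa [hl] using hlam.continuousAt.tendsto
  simpa [hn] using h1.trans_isLittleO (h3.mul_isBigO h2.norm_right) |>.norm_right

/-! ### Second order behavior along a curve. -/

section Quadratic

variable {V : Type*} [NormedAddCommGroup V] [NormedSpace ℝ V] {num : V → ℝ} {γ b : ℝ → V}

/-- The difference quotient is `k t (t⁻¹ γ t) (γ t)`, whose last argument tends to `0`; continuity
of `k` is enough. -/
lemma hasDerivAt_clm_apply_zero_zero {k : ℝ → V →L[ℝ] V →L[ℝ] ℝ} (hk : ContinuousAt k 0)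
    (hγ : DifferentiableAt ℝ γ 0) (hγ0 : γ 0 = 0) : HasDerivAt (fun t => k t (γ t) (γ t)) 0 0 := by
  rw [hasDerivAt_iff_tendsto_slope_zero]
  have hs : Tendsto (fun t : ℝ => t⁻¹ • γ t) (𝓝[≠] 0) (𝓝 (deriv γ 0)) := by
    have := hγ.hasDerivAt.tendsto_slope_zero
    simpa [hγ0] using this
  have hγt : Tendsto γ (𝓝[≠] 0) (𝓝 0) := by
    simpa [hγ0] using hγ.continuousAt.tendsto.mono_left nhdsWithin_le_nhds
  have := tendsto_clm_apply (tendsto_clm_apply (hk.tendsto.mono_left nhdsWithin_le_nhds) hs) hγt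
  simpa [hγ0] using this

set_option maxSynthPendingDepth 4 in
/-- The derivative at the origin of the differential of a quadratic expression, along a curve. -/
lemma hasDerivAt_fderiv_quadratic {B : V → V →L[ℝ] V →L[ℝ] ℝ} (hB : ContDiff ℝ ∞ B)
    (hBx : ∀ᶠ x in 𝓝 0, num x = B x x x) (hγ : DifferentiableAt ℝ γ 0) (hγ0 : γ 0 = 0)
    (hb : DifferentiableAt ℝ b 0) :
    HasDerivAt (fun t => fderiv ℝ num (γ t) (b t))
      (B 0 (b 0) (deriv γ 0) + B 0 (deriv γ 0) (b 0)) 0 := by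
  have hBd : Differentiable ℝ B := hB.differentiable (by simp)
  have e : ∀ᶠ x in 𝓝 (0 : V), ∀ w, fderiv ℝ num x w = fderiv ℝ B x w x x + B x w x + B x x w := by
    filter_upwards [hBx.eventually_nhds] with x hx w
    rw [Filter.EventuallyEq.fderiv_eq hx]
    have h1 := ((hBd x).hasFDerivAt.clm_apply (hasFDerivAt_id x)).clm_apply (hasFDerivAt_id x)
    simp only [id_eq] at h1
    rw [h1.fderiv]
    simp
    ring
  have hγt : Tendsto γ (𝓝 0) (𝓝 0) := by
    simpa [hγ0] using hγ.continuousAt.tendsto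
  have e' : (fun t => fderiv ℝ num (γ t) (b t)) =ᶠ[𝓝 0]
      fun t => fderiv ℝ B (γ t) (b t) (γ t) (γ t) + B (γ t) (b t) (γ t) + B (γ t) (γ t) (b t) := by
    filter_upwards [hγt.eventually e] with t ht using ht _
  refine HasDerivAt.congr_of_eventuallyEq ?_ e'
  have hBγ : HasDerivAt (fun t => B (γ t)) (fderiv ℝ B (γ 0) (deriv γ 0)) 0 :=
    HasFDerivAt.comp_hasDerivAt (l := B) 0 (hBd (γ 0)).hasFDerivAt hγ.hasDerivAt
  have hBc : Continuous (fderiv ℝ B) := hB.continuous_fderiv (by simp)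
  -- The term containing the derivative of `B` is quadratic in `γ t`, so it contributes nothing at
  -- first order.
  have d1 := hasDerivAt_clm_apply_zero_zero (k := fun t => fderiv ℝ B (γ t) (b t))
    (tendsto_clm_apply ((hBc.tendsto (γ 0)).comp hγ.continuousAt.tendsto) hb.continuousAt.tendsto)
    hγ hγ0
  have d2 := (hBγ.clm_apply hb.hasDerivAt).clm_apply hγ.hasDerivAt
  have d3 := (hBγ.clm_apply hγ.hasDerivAt).clm_apply hb.hasDerivAt
  exact ((d1.add d2).add d3).congr_deriv (by simp [hγ0])

end Quadratic

/-! ### The three criteria in terms of the transversal derivative of `num` along the zero curve. -/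

namespace IsSquareQuotient

variable {D : Set E2} {lam num H : E2 → ℝ} {γ b : ℝ → E2}

lemma eventually_fderiv_eq_zero_of_boundedNear (h : IsSquareQuotient D lam num H)
    (hb : BoundedNear D {x | x ∈ D ∧ lam x ≠ 0} H) (hγ : ContinuousAt γ 0) (hγ0 : γ 0 = 0)
    (hlγ : ∀ᶠ t in 𝓝 0, lam (γ t) = 0) : ∀ᶠ t in 𝓝 0, fderiv ℝ num (γ t) = 0 := by
  obtain ⟨U, hUo, hU0, hUD, C, hC⟩ := hb
  have hU' : ∀ᶠ t in 𝓝 0, γ t ∈ U := by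
    refine hγ.eventually (hUo.mem_nhds ?_)
    rwa [hγ0]
  filter_upwards [hU', hlγ] with t ht hlt
  refine fderiv_eq_zero_of_abs_le_sq hUo ht (lam := lam) (C := 2 * C) ?_ hlt fun y hy => ?_
  · exact (h.smooth_lam.contDiffAt (h.isOpen.mem_nhds (hUD ht))).differentiableAt (by simp)
  · by_cases hl : lam y = 0
    · rw [h.num_zero y (hUD hy) hl, hl]
      simp
    · have := hC y ⟨hy, hUD hy, hl⟩
      rw [h.eq y (hUD hy) hl, abs_div, div_le_iff₀ (by positivity),
        abs_of_pos (by positivity : 0 < 2 * lam y ^ 2)] at this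
      linarith

lemma fderiv_lam_deriv_eq_zero (h : IsSquareQuotient D lam num H) (hγ : DifferentiableAt ℝ γ 0)
    (hγ0 : γ 0 = 0) (hlγ : ∀ᶠ t in 𝓝 0, lam (γ t) = 0) : fderiv ℝ lam 0 (deriv γ 0) = 0 := by
  have h1 : HasFDerivAt lam (fderiv ℝ lam (γ 0)) (γ 0) := by
    rw [hγ0]
    exact ((h.smooth_lam.contDiffAt (h.isOpen.mem_nhds h.zero_mem)).differentiableAt
      (by simp)).hasFDerivAt
  have h2 := h1.comp_hasDerivAt 0 hγ.hasDerivAt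
  have h3 : (lam ∘ γ) =ᶠ[𝓝 0] fun _ => (0 : ℝ) := hlγ
  have h4 := h2.deriv
  rw [h3.deriv_eq, hγ0] at h4
  simpa using h4.symm

/-- The differential is nonzero and already kills `γ'`, so it cannot kill a complementary direction.
-/
lemma fderiv_lam_ne_zero (h : IsSquareQuotient D lam num H) (hγ : DifferentiableAt ℝ γ 0)
    (hγ0 : γ 0 = 0) (hlγ : ∀ᶠ t in 𝓝 0, lam (γ t) = 0) {w : E2}
    (hspan : ∀ x, ∃ α β : ℝ, x = α • deriv γ 0 + β • w) : fderiv ℝ lam 0 w ≠ 0 := by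
  intro hw
  apply h.fderiv_ne
  ext x
  obtain ⟨α, β, rfl⟩ := hspan x
  simp [hw, h.fderiv_lam_deriv_eq_zero hγ hγ0 hlγ]

/-- Use `(t, s) ↦ γ t + s b t` to reach all points near the origin. Both `num` and its derivative in
`s` vanish at `s = 0`, so `num = O(s²)`, while `lam` is bounded below by a multiple of `|s|`. -/
lemma boundedNear_of_eventually (h : IsSquareQuotient D lam num H) (hγ : ContDiffAt ℝ ∞ γ 0)
    (hγ0 : γ 0 = 0) (hlγ : ∀ᶠ t in 𝓝 0, lam (γ t) = 0) (hb : ContDiffAt ℝ ∞ b 0)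
    (hspan : ∀ x, ∃ α β : ℝ, x = α • deriv γ 0 + β • b 0)
    (hq : ∀ᶠ t in 𝓝 0, fderiv ℝ num (γ t) (b t) = 0) :
    BoundedNear D {x | x ∈ D ∧ lam x ≠ 0} H := by
  set m : ℝ := fderiv ℝ lam 0 (b 0) with hm
  have hm0 : m ≠ 0 := h.fderiv_lam_ne_zero (hγ.differentiableAt (by simp)) hγ0 hlγ hspan
  set Φ : ℝ × ℝ → E2 := fun z => γ z.1 + z.2 • b z.1 with hΦ
  have hγd : HasStrictDerivAt γ (deriv γ 0) 0 := hγ.hasStrictDerivAt (by simp)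
  have hbd : HasStrictDerivAt b (deriv b 0) 0 := hb.hasStrictDerivAt (by simp)
  have hΦd : HasStrictFDerivAt Φ
      ((ContinuousLinearMap.fst ℝ ℝ ℝ).smulRight (deriv γ 0) +
        (ContinuousLinearMap.snd ℝ ℝ ℝ).smulRight (b 0)) (0, 0) := by
    have h1 : HasStrictFDerivAt (fun z : ℝ × ℝ => z.1) (ContinuousLinearMap.fst ℝ ℝ ℝ) (0, 0) :=
      hasStrictFDerivAt_fst
    have h2 : HasStrictFDerivAt (fun z : ℝ × ℝ => z.2) (ContinuousLinearMap.snd ℝ ℝ ℝ) (0, 0) :=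
      hasStrictFDerivAt_snd
    have h3 := HasStrictFDerivAt.comp (g := γ) ((0, 0) : ℝ × ℝ) hγd.hasStrictFDerivAt h1
    have h4 := HasStrictFDerivAt.comp (g := b) ((0, 0) : ℝ × ℝ) hbd.hasStrictFDerivAt h1
    refine (h3.add (h2.smul h4)).congr_fderiv ?_
    ext <;> simp
  have hΦ0 : Φ (0, 0) = 0 := by simp [hΦ, hγ0]
  -- A surjective strict derivative makes `Φ` open at the origin, so bounds in `(t, s)` become
  -- bounds on a neighborhood in the plane; no inverse is needed.
  have hmap : map Φ (𝓝 (0, 0)) = 𝓝 0 := by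
    rw [← hΦ0]
    refine hΦd.map_nhds_eq_of_surj ?_
    rw [LinearMap.range_eq_top]
    intro x
    obtain ⟨α, β, rfl⟩ := hspan x
    exact ⟨(α, β), by simp⟩
  have hΦt : Tendsto Φ (𝓝 (0, 0)) (𝓝 0) := hmap.le
  have hnumC : ContDiffAt ℝ 1 (fderiv ℝ num) 0 :=
    (h.smooth_num.contDiffAt (h.isOpen.mem_nhds h.zero_mem)).fderiv_right
      (WithTop.coe_le_coe.2 le_top)
  have hlamC : ContinuousAt (fderiv ℝ lam) 0 :=
    ((h.smooth_lam.contDiffAt (h.isOpen.mem_nhds h.zero_mem)).fderiv_right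
      (m := 0) (by simp)).continuousAt
  obtain ⟨K, W, hW, hK⟩ := hnumC.exists_lipschitzOnWith
  have hfst : Tendsto (fun z : ℝ × ℝ => z.1) (𝓝 (0, 0)) (𝓝 0) := continuous_fst.tendsto (0, 0)
  have hb1 : ∀ᶠ z : ℝ × ℝ in 𝓝 (0, 0), ‖b z.1‖ < ‖b 0‖ + 1 :=
    hfst.eventually (hb.continuousAt.norm.eventually_lt_const (by linarith))
  have hlin : Tendsto (fun z : ℝ × ℝ => fderiv ℝ lam (Φ z) (b z.1)) (𝓝 (0, 0)) (𝓝 m) :=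
    tendsto_clm_apply (hlamC.tendsto.comp hΦt) (hb.continuousAt.tendsto.comp hfst)
  have hlin' : ∀ᶠ z in 𝓝 (0, 0), |fderiv ℝ lam (Φ z) (b z.1) - m| < |m| / 2 :=
    hlin.eventually (Metric.ball_mem_nhds m (by positivity : 0 < |m| / 2))
  have hall : ∀ᶠ z : ℝ × ℝ in 𝓝 (0, 0), Φ z ∈ D ∧ Φ z ∈ W ∧ ‖b z.1‖ < ‖b 0‖ + 1 ∧
      |fderiv ℝ lam (Φ z) (b z.1) - m| < |m| / 2 ∧ lam (γ z.1) = 0 ∧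
      fderiv ℝ num (γ z.1) (b z.1) = 0 :=
    (hΦt.eventually (h.isOpen.mem_nhds h.zero_mem)).and ((hΦt.eventually hW).and
      (hb1.and (hlin'.and ((hfst.eventually hlγ).and (hfst.eventually hq)))))
  obtain ⟨ρ, hρ, hball⟩ := Metric.eventually_nhds_iff_ball.1 hall
  have hseg : ∀ {t s σ : ℝ}, (t, s) ∈ Metric.ball ((0, 0) : ℝ × ℝ) ρ → |σ| ≤ |s| →
      (t, σ) ∈ Metric.ball ((0, 0) : ℝ × ℝ) ρ := by
    intro t s σ hz hσ
    rw [mem_ball_iff_norm, Prod.norm_def, max_lt_iff] at hz ⊢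
    simp only [Prod.fst_sub, Prod.snd_sub, sub_zero, Real.norm_eq_abs] at hz ⊢
    exact ⟨hz.1, hσ.trans_lt hz.2⟩
  -- One factor bounding `‖b t‖` comes from the displacement `σ b t` in the Lipschitz estimate, the
  -- other from evaluating `d num` on `b t`.
  set C : ℝ := K * (‖b 0‖ + 1) ^ 2
  have hC : 0 ≤ C := by positivity
  have hderiv : ∀ {f : E2 → ℝ}, ContDiffOn ℝ ∞ f D → ∀ {t σ : ℝ}, Φ (t, σ) ∈ D →
      HasDerivAt (fun σ => f (Φ (t, σ))) (fderiv ℝ f (Φ (t, σ)) (b t)) σ := by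
    intro f hf t σ hz
    have h1 : HasDerivAt (fun σ => Φ (t, σ)) (b t) σ := by
      have := ((hasDerivAt_id σ).smul_const (b t)).const_add (γ t)
      rwa [one_smul] at this
    exact ((hf.contDiffAt (h.isOpen.mem_nhds hz)).differentiableAt
      (by simp)).hasFDerivAt.comp_hasDerivAt σ h1
  have hΦz : ∀ t, Φ (t, 0) = γ t := fun t => by simp [hΦ]
  have hnum : ∀ t s, (t, s) ∈ Metric.ball ((0, 0) : ℝ × ℝ) ρ → |num (Φ (t, s))| ≤ C * s ^ 2 := by
    intro t s hz
    obtain ⟨-, hW0, hbt, -, hl0, hq0⟩ := hball _ (hseg hz (σ := 0) (by simp))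
    have hD0 := (hball _ (hseg hz (σ := 0) (by simp))).1
    have hn0 : num (Φ (t, 0)) = 0 := h.num_zero _ hD0 (by rw [hΦz]; exact hl0)
    have := abs_sub_le_of_hasDerivAt (k := fun σ => num (Φ (t, σ))) (s := s) (C := C * |s|)
      (fun σ hσ => hderiv h.smooth_num (hball _ (hseg hz hσ)).1) (fun σ hσ => ?_)
    · rw [hn0, sub_zero, mul_assoc, abs_mul_abs_self] at this
      rwa [sq]
    · have e1 : fderiv ℝ num (Φ (t, σ)) (b t) =
          (fderiv ℝ num (Φ (t, σ)) - fderiv ℝ num (Φ (t, 0))) (b t) := by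
        rw [sub_apply, hΦz, hq0, sub_zero]
      have e2 : ‖fderiv ℝ num (Φ (t, σ)) - fderiv ℝ num (Φ (t, 0))‖ ≤ K * (|σ| * ‖b t‖) := by
        refine (hK.norm_sub_le (hball _ (hseg hz hσ)).2.1 hW0).trans_eq ?_
        simp [hΦ, norm_smul]
      rw [e1]
      calc |(fderiv ℝ num (Φ (t, σ)) - fderiv ℝ num (Φ (t, 0))) (b t)|
          ≤ ‖fderiv ℝ num (Φ (t, σ)) - fderiv ℝ num (Φ (t, 0))‖ * ‖b t‖ :=
            (fderiv ℝ num (Φ (t, σ)) - fderiv ℝ num (Φ (t, 0))).le_opNorm (b t)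
        _ ≤ K * (|s| * (‖b 0‖ + 1)) * (‖b 0‖ + 1) := by
            refine mul_le_mul (e2.trans ?_) hbt.le (norm_nonneg _) (by positivity)
            gcongr
        _ = C * |s| := by ring
  have hlam : ∀ t s, (t, s) ∈ Metric.ball ((0, 0) : ℝ × ℝ) ρ → |m| / 2 * |s| ≤ |lam (Φ (t, s))| := by
    intro t s hz
    have hl0 := (hball _ (hseg hz (σ := 0) (by simp))).2.2.2.2.1
    -- Subtracting the linear part `σ m` leaves a derivative of size at most `|m| / 2`, hence the
    -- lower bound.
    have := abs_sub_le_of_hasDerivAt (k := fun σ => lam (Φ (t, σ)) - σ * m) (s := s) (C := |m| / 2)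
      (fun σ hσ => (hderiv h.smooth_lam (hball _ (hseg hz hσ)).1).sub
        ((hasDerivAt_id σ).mul_const m)) (fun σ hσ => ?_)
    · simp only [hΦz, hl0, zero_mul, sub_zero] at this
      have h1 : |s * m| ≤ |lam (Φ (t, s)) - s * m| + |lam (Φ (t, s))| := by
        have := abs_sub_le (s * m) (lam (Φ (t, s))) 0
        rwa [sub_zero, sub_zero, abs_sub_comm] at this
      rw [abs_mul] at h1
      linarith
    · rw [one_mul]
      exact (hball _ (hseg hz hσ)).2.2.2.1.le
  -- The constant comes from `|num| ≤ C s²` and `lam² ≥ m² s² / 4`.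
  have hbound : ∀ᶠ x in 𝓝 (0 : E2), x ∈ D ∧ (lam x ≠ 0 → |H x| ≤ 2 * C / m ^ 2) := by
    rw [← hmap, eventually_map]
    filter_upwards [Metric.ball_mem_nhds _ hρ] with z hz
    have hD := (hball z hz).1
    refine ⟨hD, fun hl => ?_⟩
    have h1 := hnum z.1 z.2 hz
    have h2 := hlam z.1 z.2 hz
    rw [h.eq _ hD hl, abs_div, abs_of_pos (by positivity : 0 < 2 * lam (Φ z) ^ 2),
      div_le_div_iff₀ (by positivity) (by positivity)]
    have h3 : m ^ 2 * z.2 ^ 2 ≤ 4 * lam (Φ z) ^ 2 := by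
      have := pow_le_pow_left₀ (by positivity) h2 2
      rw [mul_pow, div_pow, sq_abs, sq_abs, sq_abs] at this
      linarith
    calc |num (Φ z)| * m ^ 2 ≤ C * z.2 ^ 2 * m ^ 2 := by gcongr
      _ = C * (m ^ 2 * z.2 ^ 2) := by ring
      _ ≤ C * (4 * lam (Φ z) ^ 2) := by gcongr
      _ = 2 * C * (2 * lam (Φ z) ^ 2) := by ring
  obtain ⟨U, hU, hUo, hU0⟩ := eventually_nhds_iff.1 hbound
  exact ⟨U, hUo, hU0, fun x hx => (hU x hx).1, _, fun x hx => (hU x hx.1).2 hx.2.2⟩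

lemma boundedNear_iff (h : IsSquareQuotient D lam num H) (hγ : ContDiffAt ℝ ∞ γ 0)
    (hγ0 : γ 0 = 0) (hlγ : ∀ᶠ t in 𝓝 0, lam (γ t) = 0) (hb : ContDiffAt ℝ ∞ b 0)
    (hspan : ∀ x, ∃ α β : ℝ, x = α • deriv γ 0 + β • b 0) :
    BoundedNear D {x | x ∈ D ∧ lam x ≠ 0} H ↔ ∀ᶠ t in 𝓝 0, fderiv ℝ num (γ t) (b t) = 0 := by
  refine ⟨fun hbd => ?_, h.boundedNear_of_eventually hγ hγ0 hlγ hb hspan⟩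
  filter_upwards [h.eventually_fderiv_eq_zero_of_boundedNear hbd hγ.continuousAt hγ0 hlγ] with t ht
  simp [ht]

lemma eventually_num_eq_zero (h : IsSquareQuotient D lam num H) (hγ : ContinuousAt γ 0)
    (hγ0 : γ 0 = 0) (hlγ : ∀ᶠ t in 𝓝 0, lam (γ t) = 0) : ∀ᶠ t in 𝓝 0, num (γ t) = 0 := by
  have hD : ∀ᶠ t in 𝓝 0, γ t ∈ D := by
    refine hγ.eventually (h.isOpen.mem_nhds ?_)
    rw [hγ0]
    exact h.zero_mem
  filter_upwards [hD, hlγ] with t ht hl using h.num_zero _ ht hl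

lemma fderiv_num_eq_zero (h : IsSquareQuotient D lam num H) (hγ : ContDiffAt ℝ ∞ γ 0)
    (hγ0 : γ 0 = 0) (hlγ : ∀ᶠ t in 𝓝 0, lam (γ t) = 0) {w : E2}
    (hspan : ∀ x, ∃ α β : ℝ, x = α • deriv γ 0 + β • w) (hq : fderiv ℝ num 0 w = 0) :
    fderiv ℝ num 0 = 0 := by
  have h1 : HasFDerivAt num (fderiv ℝ num (γ 0)) (γ 0) := by
    rw [hγ0]
    exact ((h.smooth_num.contDiffAt (h.isOpen.mem_nhds h.zero_mem)).differentiableAt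
      (by simp)).hasFDerivAt
  have h2 := (h1.comp_hasDerivAt 0 (hγ.differentiableAt (by simp)).hasDerivAt).deriv
  have h3 : (num ∘ γ) =ᶠ[𝓝 0] fun _ => (0 : ℝ) :=
    h.eventually_num_eq_zero hγ.continuousAt hγ0 hlγ
  rw [h3.deriv_eq, hγ0, deriv_const] at h2
  ext x
  obtain ⟨α, β, rfl⟩ := hspan x
  simp [hq, ← h2]

lemma rationallyBounded_iff (h : IsSquareQuotient D lam num H) (hγ : ContDiffAt ℝ ∞ γ 0)
    (hγ0 : γ 0 = 0) (hlγ : ∀ᶠ t in 𝓝 0, lam (γ t) = 0)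
    (hspan : ∀ x, ∃ α β : ℝ, x = α • deriv γ 0 + β • b 0) :
    RationallyBounded D {x | x ∈ D ∧ lam x ≠ 0} H ↔ fderiv ℝ num (γ 0) (b 0) = 0 := by
  constructor
  · intro hb
    rw [hγ0, h.fderiv_num_eq_zero_of_rationallyBounded hb]
    rfl
  · intro hq
    rw [hγ0] at hq
    obtain ⟨B, hB, hBx⟩ := exists_eventually_eq_clm_apply_self_self h.isOpen h.zero_mem
      h.smooth_num h.num_at_zero (h.fderiv_num_eq_zero hγ hγ0 hlγ hspan hq)
    obtain ⟨U, hU, Lam, psi, hp, -⟩ := h.exists_isRationalPair hB hBx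
    exact ⟨U, hU, Lam, psi, hp⟩

/-- Divide `0 = num (γ t) = B (γ t) (γ t) (γ t)` by `t²` and let `t → 0`. -/
lemma quadratic_deriv_eq_zero (h : IsSquareQuotient D lam num H) {B : E2 → E2 →L[ℝ] E2 →L[ℝ] ℝ}
    (hB : ContDiff ℝ ∞ B) (hBx : ∀ᶠ x in 𝓝 0, num x = B x x x) (hγ : DifferentiableAt ℝ γ 0)
    (hγ0 : γ 0 = 0) (hlγ : ∀ᶠ t in 𝓝 0, lam (γ t) = 0) : B 0 (deriv γ 0) (deriv γ 0) = 0 := by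
  have hγt : Tendsto γ (𝓝 0) (𝓝 0) := by
    simpa [hγ0] using hγ.continuousAt.tendsto
  have hs : Tendsto (fun t : ℝ => t⁻¹ • γ t) (𝓝[≠] 0) (𝓝 (deriv γ 0)) := by
    have := hγ.hasDerivAt.tendsto_slope_zero
    simpa [hγ0] using this
  have hlim : Tendsto (fun t : ℝ => B (γ t) (t⁻¹ • γ t) (t⁻¹ • γ t)) (𝓝[≠] 0)
      (𝓝 (B 0 (deriv γ 0) (deriv γ 0))) :=
    tendsto_clm_apply (tendsto_clm_apply
      (((hB.continuous.tendsto 0).comp hγt).mono_left nhdsWithin_le_nhds) hs) hs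
  refine tendsto_nhds_unique hlim (tendsto_const_nhds.congr' ?_)
  have := (h.eventually_num_eq_zero hγ.continuousAt hγ0 hlγ).and (hγt.eventually hBx)
  filter_upwards [this.filter_mono nhdsWithin_le_nhds] with t ht
  rw [map_smul, map_smul, smul_apply, ← ht.2, ht.1]
  simp

/-- In the basis `γ'`, `b` the form `dλ²` has only a `b, b` coefficient, and `B 0` has no `γ', γ'`
coefficient. Proportionality is therefore the vanishing of the symmetrized mixed coefficient, which
is the derivative on the right. `B 0` is not assumed symmetric. -/
lemma rationallyContinuous_iff (h : IsSquareQuotient D lam num H) (hγ : ContDiffAt ℝ ∞ γ 0)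
    (hγ0 : γ 0 = 0) (hlγ : ∀ᶠ t in 𝓝 0, lam (γ t) = 0) (hb : ContDiffAt ℝ ∞ b 0)
    (hspan : ∀ x, ∃ α β : ℝ, x = α • deriv γ 0 + β • b 0) :
    RationallyContinuous D {x | x ∈ D ∧ lam x ≠ 0} H ↔
      fderiv ℝ num (γ 0) (b 0) = 0 ∧ HasDerivAt (fun t => fderiv ℝ num (γ t) (b t)) 0 0 := by
  have hγd : DifferentiableAt ℝ γ 0 := hγ.differentiableAt (by simp)
  have hbd : DifferentiableAt ℝ b 0 := hb.differentiableAt (by simp)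
  have hla := h.fderiv_lam_deriv_eq_zero hγd hγ0 hlγ
  constructor
  · intro hc
    have hrb : RationallyBounded D {x | x ∈ D ∧ lam x ≠ 0} H := by
      obtain ⟨U, hU, Lam, psi, hp, -⟩ := hc
      exact ⟨U, hU, Lam, psi, hp⟩
    obtain ⟨B, hB, hBx⟩ := exists_eventually_eq_clm_apply_self_self h.isOpen h.zero_mem
      h.smooth_num h.num_at_zero (h.fderiv_num_eq_zero_of_rationallyBounded hrb)
    refine ⟨(h.rationallyBounded_iff hγ hγ0 hlγ hspan).1 hrb, ?_⟩
    convert hasDerivAt_fderiv_quadratic hB hBx hγd hγ0 hbd using 1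
    obtain ⟨c, hc⟩ := h.exists_quadratic_eq_of_rationallyContinuous hc hB hBx
    -- Polarization isolates the mixed term.
    have h1 := hc (deriv γ 0 + b 0)
    have h2 := hc (deriv γ 0)
    have h3 := hc (b 0)
    simp only [map_add, add_apply, hla] at h1 h2
    linear_combination h2 + h3 - h1
  · rintro ⟨hq, hq'⟩
    rw [hγ0] at hq
    obtain ⟨B, hB, hBx⟩ := exists_eventually_eq_clm_apply_self_self h.isOpen h.zero_mem
      h.smooth_num h.num_at_zero (h.fderiv_num_eq_zero hγ hγ0 hlγ hspan hq)
    obtain ⟨U, hU, Lam, psi, hp, hv⟩ := h.exists_isRationalPair hB hBx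
    have hne := h.fderiv_lam_ne_zero hγd hγ0 hlγ hspan
    have hsym := hq'.unique (hasDerivAt_fderiv_quadratic hB hBx hγd hγ0 hbd)
    have haa := h.quadratic_deriv_eq_zero hB hBx hγd hγ0 hlγ
    -- The constant is the ratio `psi / Lam` in the direction `b 0`.
    refine ⟨U, hU, Lam, psi, hp, B 0 (b 0) (b 0) / (2 * fderiv ℝ lam 0 (b 0) ^ 2), fun q hq0 => ?_⟩
    obtain ⟨r, θ, rfl⟩ := q.exists_mk
    rw [BlowUp.proj_mk_eq_zero] at hq0
    subst hq0
    rw [(hv θ).1, (hv θ).2]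
    obtain ⟨α, β, hαβ⟩ := hspan (dir θ)
    rw [hαβ]
    simp only [map_add, map_smul, add_apply, smul_apply, smul_eq_mul, hla, haa]
    field_simp
    linear_combination (-α * β * fderiv ℝ lam 0 (b 0) ^ 2) * hsym

end IsSquareQuotient

/-! ### Linear algebra of a metric at a point -/

section Pointwise

variable {G : E3 → Matrix (Fin 3) (Fin 3) ℝ} {y : E3}

lemma ip_eq_sum (a b : E3) : ip G y a b =
    G y 0 0 * a 0 * b 0 + G y 0 1 * a 0 * b 1 + G y 0 2 * a 0 * b 2 +
    (G y 1 0 * a 1 * b 0 + G y 1 1 * a 1 * b 1 + G y 1 2 * a 1 * b 2) +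
    (G y 2 0 * a 2 * b 0 + G y 2 1 * a 2 * b 1 + G y 2 2 * a 2 * b 2) := by
  simp [ip, Fin.sum_univ_three]

lemma ip_add_left (a a' b : E3) : ip G y (a + a') b = ip G y a b + ip G y a' b := by
  simp only [ip_eq_sum, PiLp.add_apply]; ring

lemma ip_add_right (a b b' : E3) : ip G y a (b + b') = ip G y a b + ip G y a b' := by
  simp only [ip_eq_sum, PiLp.add_apply]; ring

lemma ip_smul_left (r : ℝ) (a b : E3) : ip G y (r • a) b = r * ip G y a b := by
  simp only [ip_eq_sum, PiLp.smul_apply, smul_eq_mul]; ring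

lemma ip_smul_right (r : ℝ) (a b : E3) : ip G y a (r • b) = r * ip G y a b := by
  simp only [ip_eq_sum, PiLp.smul_apply, smul_eq_mul]; ring

@[simp] lemma ip_zero_left (b : E3) : ip G y 0 b = 0 := by simp [ip]

@[simp] lemma ip_zero_right (a : E3) : ip G y a 0 = 0 := by simp [ip]

lemma ip_eq_dotProduct (a b : E3) : ip G y a b = a.ofLp ⬝ᵥ (G y).mulVec b.ofLp := by
  simp only [ip_eq_sum, dotProduct, Matrix.mulVec, Fin.sum_univ_three]; ring

lemma detg_eq (a b c : E3) : detg G y a b c = √((G y).det) *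
    (a 0 * b 1 * c 2 - a 0 * b 2 * c 1 - a 1 * b 0 * c 2 + a 1 * b 2 * c 0 + a 2 * b 0 * c 1
      - a 2 * b 1 * c 0) := by
  simp [detg, Matrix.det_fin_three]

lemma detg_swap_right (a b c : E3) : detg G y a c b = -detg G y a b c := by
  simp only [detg_eq]; ring

lemma ip_comm (hs : ∀ i j, G y i j = G y j i) (a b : E3) : ip G y a b = ip G y b a := by
  simp only [ip_eq_sum, hs 1 0, hs 2 0, hs 2 1]; ring

lemma metric_mulVec_ne_zero (hp : ∀ a, a ≠ 0 → 0 < ip G y a a) {n : E3} (hn : n ≠ 0) : (G y).mulVec n.ofLp ≠ 0 := by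
  intro h
  have := hp n hn
  rw [ip_eq_dotProduct, h] at this
  simp at this

lemma metric_det_pos (hs : ∀ i j, G y i j = G y j i)
    (hp : ∀ a, a ≠ 0 → 0 < ip G y a a) : 0 < (G y).det := by
  refine Matrix.PosDef.det_pos (Matrix.PosDef.of_dotProduct_mulVec_pos ?_ fun x hx => ?_)
  · ext i j
    simp [hs i j]
  · have := hp (WithLp.toLp 2 x) (by simpa using hx)
    rw [ip_eq_dotProduct] at this
    simpa using this

lemma ip_inv_mulVec (hs : ∀ i j, G y i j = G y j i)
    (hp : ∀ a, a ≠ 0 → 0 < ip G y a a) (u : Fin 3 → ℝ) (c : E3) :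
    ip G y (WithLp.toLp 2 ((G y)⁻¹.mulVec u)) c = u ⬝ᵥ c.ofLp := by
  rw [ip_comm hs, ip_eq_dotProduct, Matrix.mulVec_mulVec,
    Matrix.mul_nonsing_inv _ (metric_det_pos hs hp).ne'.isUnit, Matrix.one_mulVec, dotProduct_comm]

lemma ip_crossg (hs : ∀ i j, G y i j = G y j i)
    (hp : ∀ a, a ≠ 0 → 0 < ip G y a a) (a b c : E3) : ip G y (crossg G y a b) c = detg G y a b c := by
  rw [crossg, WithLp.toLp_smul, ip_smul_left, ip_inv_mulVec hs hp, detg_eq]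
  simp [cross_apply, dotProduct, Fin.sum_univ_three]
  ring_nf
  simp

/-- Only the normal component of `w` counts: once it is removed, all three vectors lie in the plane
orthogonal to `n`. The dependence is witnessed by the nonzero vector `G n`, annihilated by the
matrix of rows. -/
lemma detg_eq_mul_ip (hs : ∀ i j, G y i j = G y j i)
    (hp : ∀ a, a ≠ 0 → 0 < ip G y a a) {n a c : E3} (hn : ip G y n n = 1) (ha : ip G y a n = 0)
    (hc : ip G y c n = 0) (w : E3) :
    detg G y a c w = detg G y a c n * ip G y n w := by
  have hn0 : n ≠ 0 := by
    rintro rfl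
    simp at hn
  set w' : E3 := w - ip G y n w • n with hw'
  have hw : ip G y w' n = 0 := by
    rw [hw', sub_eq_add_neg, ← neg_smul, ip_add_left, ip_smul_left, hn, ip_comm hs w n]
    ring
  have hdet : Matrix.det (Matrix.of ![a.ofLp, c.ofLp, w'.ofLp]) = 0 := by
    rw [← Matrix.exists_mulVec_eq_zero_iff]
    refine ⟨(G y).mulVec n.ofLp, metric_mulVec_ne_zero hp hn0, ?_⟩
    rw [ip_eq_dotProduct] at ha hc hw
    ext i
    fin_cases i
    · exact ha
    · exact hc
    · exact hw
  simp only [Matrix.det_fin_three, Matrix.of_apply, Matrix.cons_val, hw', PiLp.sub_apply,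
    PiLp.smul_apply, smul_eq_mul] at hdet
  simp only [detg_eq]
  linear_combination √((G y).det) * hdet

/-- Apply `detg_eq_mul_ip` to `w = a × c`: the squared length is the square of `detg G y a c n`. -/
lemma len_crossg (hs : ∀ i j, G y i j = G y j i)
    (hp : ∀ a, a ≠ 0 → 0 < ip G y a a) {n a c : E3} (hn : ip G y n n = 1) (ha : ip G y a n = 0) (hc : ip G y c n = 0) :
    len G y (crossg G y a c) = |detg G y a c n| := by
  rw [len, ip_crossg hs hp, detg_eq_mul_ip hs hp hn ha hc, ip_comm hs n, ip_crossg hs hp,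
    Real.sqrt_mul_self_eq_abs]

/-- The Gram matrix of `a, c, n` is `P G Pᵀ`; since `n` is a unit vector orthogonal to `a` and `c`,
its determinant reduces to the two by two minor. -/
lemma ip_mul_ip_sub_sq (hs : ∀ i j, G y i j = G y j i)
    (hp : ∀ a, a ≠ 0 → 0 < ip G y a a) {n a c : E3} (hn : ip G y n n = 1) (ha : ip G y a n = 0)
    (hc : ip G y c n = 0) :
    ip G y a a * ip G y c c - ip G y a c ^ 2 = detg G y a c n ^ 2 := by
  set P : Matrix (Fin 3) (Fin 3) ℝ := Matrix.of ![a.ofLp, c.ofLp, n.ofLp] with hP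
  have hdet : (P * G y * P.transpose).det = detg G y a c n ^ 2 := by
    rw [Matrix.det_mul, Matrix.det_mul, Matrix.det_transpose, detg, mul_pow,
      Real.sq_sqrt (metric_det_pos hs hp).le]
    ring
  have hent : P * G y * P.transpose = Matrix.of
      ![![ip G y a a, ip G y a c, ip G y a n], ![ip G y c a, ip G y c c, ip G y c n],
        ![ip G y n a, ip G y n c, ip G y n n]] := by
    ext i j
    fin_cases i <;> fin_cases j <;>
      simp [hP, Matrix.vecMul, dotProduct, Matrix.mul_apply, Fin.sum_univ_three, ip_eq_sum] <;> ring
  rw [← hdet, hent, Matrix.det_fin_three]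
  simp only [Matrix.of_apply, Matrix.cons_val, ha, hc, hn, ip_comm hs n, ip_comm hs c a]
  ring

end Pointwise

/-! ### The Levi-Civita connection in coordinates -/

/-- A smooth Riemannian metric on an open subset of the coordinate space. -/
structure IsMetricOn (G : E3 → Matrix (Fin 3) (Fin 3) ℝ) (T : Set E3) : Prop where
  isOpen : IsOpen T
  smooth : ∀ i j, ContDiffOn ℝ ∞ (fun y => G y i j) T
  symm : ∀ y ∈ T, ∀ i j, G y i j = G y j i
  pos : ∀ y ∈ T, ∀ a, a ≠ 0 → 0 < ip G y a a

/-- The Christoffel symbols of the first kind. -/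
def christoffelLow (G : E3 → Matrix (Fin 3) (Fin 3) ℝ) (y : E3) (l i j : Fin 3) : ℝ :=
  (1 / 2) * (fderiv ℝ (fun z => G z j l) y (dx i) + fderiv ℝ (fun z => G z i l) y (dx j)
      - fderiv ℝ (fun z => G z i j) y (dx l))

/-- The zeroth order part of the covariant derivative. -/
def christoffelVec (G : E3 → Matrix (Fin 3) (Fin 3) ℝ) (y v w : E3) : E3 :=
  WithLp.toLp 2 (fun k => ∑ i, ∑ j, christoffel G y k i j * v i * w j)

lemma covDeriv_eq (G : E3 → Matrix (Fin 3) (Fin 3) ℝ) (F : E2 → E3) (X : E2 → E2) (W : E2 → E3)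
    (x : E2) : covDeriv G F X W x =
      fderiv ℝ W x (X x) + christoffelVec G (F x) (fderiv ℝ F x (X x)) (W x) := rfl

lemma christoffel_eq_sum (G : E3 → Matrix (Fin 3) (Fin 3) ℝ) (y : E3) (k i j : Fin 3) :
    christoffel G y k i j = ∑ l, (G y)⁻¹ k l * christoffelLow G y l i j := by
  simp only [christoffel, christoffelLow, Fin.sum_univ_three]
  ring

lemma christoffelVec_eq (G : E3 → Matrix (Fin 3) (Fin 3) ℝ) (y v w : E3) :
    christoffelVec G y v w = WithLp.toLp 2 ((G y)⁻¹.mulVec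
      fun l => ∑ i, ∑ j, christoffelLow G y l i j * v i * w j) := by
  rw [christoffelVec]
  congr 1
  ext k
  simp only [christoffel_eq_sum, Matrix.mulVec, dotProduct, Fin.sum_univ_three]
  ring

lemma christoffelVec_add_left (G : E3 → Matrix (Fin 3) (Fin 3) ℝ) (y v v' w : E3) :
    christoffelVec G y (v + v') w = christoffelVec G y v w + christoffelVec G y v' w := by
  ext k
  simp only [christoffelVec, PiLp.add_apply, Fin.sum_univ_three]
  ring

lemma christoffelVec_smul_left (G : E3 → Matrix (Fin 3) (Fin 3) ℝ) (r : ℝ) (y v w : E3) :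
    christoffelVec G y (r • v) w = r • christoffelVec G y v w := by
  ext k
  simp only [christoffelVec, PiLp.smul_apply, smul_eq_mul, Fin.sum_univ_three]
  ring

namespace IsMetricOn

variable {G : E3 → Matrix (Fin 3) (Fin 3) ℝ} {T : Set E3}

lemma fderiv_symm (hG : IsMetricOn G T) {y : E3} (hy : y ∈ T) (i j : Fin 3) :
    fderiv ℝ (fun z => G z i j) y = fderiv ℝ (fun z => G z j i) y := by
  refine Filter.EventuallyEq.fderiv_eq ?_
  filter_upwards [hG.isOpen.mem_nhds hy] with z hz using hG.symm z hz i j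

lemma christoffelVec_comm (hG : IsMetricOn G T) {y : E3} (hy : y ∈ T) (v w : E3) :
    christoffelVec G y v w = christoffelVec G y w v := by
  have hsymm : ∀ l i j, christoffelLow G y l i j = christoffelLow G y l j i := by
    intro l i j
    rw [christoffelLow, christoffelLow, hG.fderiv_symm hy i j]
    ring
  rw [christoffelVec_eq, christoffelVec_eq]
  congr 2
  ext l
  rw [Finset.sum_comm]
  refine Finset.sum_congr rfl fun i _ => Finset.sum_congr rfl fun j _ => ?_
  rw [hsymm]
  ring

/-- Metric compatibility at the level of coefficients: in the sum of the two Christoffel symbols of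
the first kind all but the derivative along `v` cancel. -/
lemma sum_fderiv_eq (hG : IsMetricOn G T) {y : E3} (hy : y ∈ T) (v w w' : E3) :
    ∑ i, ∑ j, fderiv ℝ (fun z => G z i j) y v * w i * w' j =
      ip G y (christoffelVec G y v w) w' + ip G y w (christoffelVec G y v w') := by
  have hv : v = v 0 • dx 0 + v 1 • dx 1 + v 2 • dx 2 := by
    ext i
    fin_cases i <;> simp [dx]
  have hd : ∀ i j, fderiv ℝ (fun z => G z i j) y v = v 0 * fderiv ℝ (fun z => G z i j) y (dx 0) +
      v 1 * fderiv ℝ (fun z => G z i j) y (dx 1) + v 2 * fderiv ℝ (fun z => G z i j) y (dx 2) := by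
    intro i j
    conv_lhs => rw [hv]
    simp only [map_add, map_smul, smul_eq_mul]
  rw [ip_comm (hG.symm y hy) w, christoffelVec_eq, christoffelVec_eq,
    ip_inv_mulVec (hG.symm y hy) (hG.pos y hy), ip_inv_mulVec (hG.symm y hy) (hG.pos y hy)]
  simp only [hd, dotProduct, christoffelLow, Fin.sum_univ_three, hG.fderiv_symm hy 1 0,
    hG.fderiv_symm hy 2 0, hG.fderiv_symm hy 2 1]
  ring

end IsMetricOn

/-! ### Smoothness of the metric operations along a map -/

lemma contDiffAt_coord {E : Type*} [NormedAddCommGroup E] [NormedSpace ℝ E] {ι : Type*} [Fintype ι]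
    {W : E → EuclideanSpace ℝ ι} {x : E} (hW : ContDiffAt ℝ ∞ W x) (i : ι) :
    ContDiffAt ℝ ∞ (fun x => W x i) x :=
  contDiffAt_euclidean.1 hW i

lemma ContDiffAt.fderiv_top {E E' : Type*} [NormedAddCommGroup E] [NormedSpace ℝ E]
    [NormedAddCommGroup E'] [NormedSpace ℝ E'] {k : E → E'} {x : E} (hk : ContDiffAt ℝ ∞ k x) :
    ContDiffAt ℝ ∞ (fderiv ℝ k) x :=
  hk.fderiv_right (m := ∞) (by simp)

namespace IsMetricOn

variable {G : E3 → Matrix (Fin 3) (Fin 3) ℝ} {T : Set E3}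

lemma contDiffAt_entry (hG : IsMetricOn G T) {y : E3} (hy : y ∈ T) (i j : Fin 3) :
    ContDiffAt ℝ ∞ (fun y => G y i j) y :=
  (hG.smooth i j).contDiffAt (hG.isOpen.mem_nhds hy)

lemma contDiffAt_det (hG : IsMetricOn G T) {y : E3} (hy : y ∈ T) :
    ContDiffAt ℝ ∞ (fun y => (G y).det) y := by
  have h := hG.contDiffAt_entry hy
  simp only [Matrix.det_fin_three]
  exact (((((((h 0 0).mul (h 1 1)).mul (h 2 2)).sub (((h 0 0).mul (h 1 2)).mul (h 2 1))).sub
    (((h 0 1).mul (h 1 0)).mul (h 2 2))).add (((h 0 1).mul (h 1 2)).mul (h 2 0))).add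
    (((h 0 2).mul (h 1 0)).mul (h 2 1))).sub (((h 0 2).mul (h 1 1)).mul (h 2 0))

lemma det_pos (hG : IsMetricOn G T) {y : E3} (hy : y ∈ T) : 0 < (G y).det :=
  metric_det_pos (hG.symm y hy) (hG.pos y hy)

lemma contDiffAt_sqrt_det (hG : IsMetricOn G T) {y : E3} (hy : y ∈ T) :
    ContDiffAt ℝ ∞ (fun y => √((G y).det)) y :=
  (hG.contDiffAt_det hy).sqrt (hG.det_pos hy).ne'

lemma contDiffAt_inv (hG : IsMetricOn G T) {y : E3} (hy : y ∈ T) (i j : Fin 3) :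
    ContDiffAt ℝ ∞ (fun y => (G y)⁻¹ i j) y := by
  have h := hG.contDiffAt_entry hy
  have hd := (hG.contDiffAt_det hy).inv (hG.det_pos hy).ne'
  simp only [Matrix.inv_def, Ring.inverse_eq_inv', Matrix.smul_apply, smul_eq_mul]
  refine hd.mul ?_
  fin_cases i <;> fin_cases j <;>
    simp only [Matrix.adjugate_fin_three, Matrix.of_apply, Matrix.cons_val, Fin.zero_eta,
      Fin.mk_one, Fin.reduceFinMk]
  all_goals fun_prop

lemma contDiffAt_christoffel (hG : IsMetricOn G T) {y : E3} (hy : y ∈ T) (k i j : Fin 3) :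
    ContDiffAt ℝ ∞ (fun y => christoffel G y k i j) y := by
  have h : ∀ i j (v : E3), ContDiffAt ℝ ∞ (fun y => fderiv ℝ (fun z => G z i j) y v) y :=
    fun i j v => (ContDiffAt.fderiv_top (hG.contDiffAt_entry hy i j)).clm_apply contDiffAt_const
  refine contDiffAt_const.mul (ContDiffAt.sum fun l _ => (hG.contDiffAt_inv hy k l).mul ?_)
  exact ((h _ _ _).add (h _ _ _)).sub (h _ _ _)

end IsMetricOn

/-- The coordinate expression of a frontal with unit normal field `N` on the open set `D`. -/
structure IsFrontalOn (D : Set E2) (T : Set E3) (G : E3 → Matrix (Fin 3) (Fin 3) ℝ)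
    (F N : E2 → E3) : Prop where
  isOpen : IsOpen D
  metric : IsMetricOn G T
  maps : ∀ x ∈ D, F x ∈ T
  smooth : ContDiffOn ℝ ∞ F D
  smooth_normal : ContDiffOn ℝ ∞ N D
  unit : ∀ x ∈ D, ip G (F x) (N x) (N x) = 1
  normal : ∀ x ∈ D, ∀ a, ip G (F x) (fderiv ℝ F x a) (N x) = 0

/-! ### Frontals in coordinates: smoothness, the connection along the map, and the second
fundamental form. -/

namespace IsFrontalOn

variable {D : Set E2} {T : Set E3} {G : E3 → Matrix (Fin 3) (Fin 3) ℝ} {F N : E2 → E3}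
  {W W' : E2 → E3} {X : E2 → E2} {x : E2}

lemma contDiffAt (h : IsFrontalOn D T G F N) (hx : x ∈ D) : ContDiffAt ℝ ∞ F x :=
  h.smooth.contDiffAt (h.isOpen.mem_nhds hx)

lemma contDiffAt_normal (h : IsFrontalOn D T G F N) (hx : x ∈ D) : ContDiffAt ℝ ∞ N x :=
  h.smooth_normal.contDiffAt (h.isOpen.mem_nhds hx)

lemma ip_comm (h : IsFrontalOn D T G F N) (hx : x ∈ D) (a b : E3) :
    ip G (F x) a b = ip G (F x) b a :=
  FrontalGeometry.ip_comm (h.metric.symm _ (h.maps x hx)) a b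

lemma contDiffAt_entry (h : IsFrontalOn D T G F N) (hx : x ∈ D) (i j : Fin 3) :
    ContDiffAt ℝ ∞ (fun x => G (F x) i j) x :=
  (h.metric.contDiffAt_entry (h.maps x hx) i j).comp x (h.contDiffAt hx)

lemma contDiffAt_ip (h : IsFrontalOn D T G F N) (hx : x ∈ D) (hW : ContDiffAt ℝ ∞ W x)
    (hW' : ContDiffAt ℝ ∞ W' x) : ContDiffAt ℝ ∞ (fun x => ip G (F x) (W x) (W' x)) x :=
  ContDiffAt.sum fun i _ => ContDiffAt.sum fun j _ =>
    ((h.contDiffAt_entry hx i j).mul (contDiffAt_coord hW i)).mul (contDiffAt_coord hW' j)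

lemma contDiffAt_covDeriv (h : IsFrontalOn D T G F N) (hx : x ∈ D) (hX : ContDiffAt ℝ ∞ X x)
    (hW : ContDiffAt ℝ ∞ W x) : ContDiffAt ℝ ∞ (covDeriv G F X W) x := by
  refine ((ContDiffAt.fderiv_top hW).clm_apply hX).add ?_
  rw [contDiffAt_euclidean]
  intro k
  show ContDiffAt ℝ ∞ (fun x => ∑ i, ∑ j,
    christoffel G (F x) k i j * (fderiv ℝ F x (X x)) i * W x j) x
  refine ContDiffAt.sum fun i _ => ContDiffAt.sum fun j _ => ContDiffAt.mul (ContDiffAt.mul ?_ ?_)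
    (contDiffAt_coord hW j)
  · exact (h.metric.contDiffAt_christoffel (h.maps x hx) k i j).comp x (h.contDiffAt hx)
  · exact contDiffAt_coord ((ContDiffAt.fderiv_top (h.contDiffAt hx)).clm_apply hX) i

lemma contDiffAt_detg (h : IsFrontalOn D T G F N) (hx : x ∈ D) {W'' : E2 → E3}
    (hW : ContDiffAt ℝ ∞ W x) (hW' : ContDiffAt ℝ ∞ W' x) (hW'' : ContDiffAt ℝ ∞ W'' x) :
    ContDiffAt ℝ ∞ (fun x => detg G (F x) (W x) (W' x) (W'' x)) x := by
  have h1 : ContDiffAt ℝ ∞ (fun x => √((G (F x)).det)) x :=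
    (h.metric.contDiffAt_sqrt_det (h.maps x hx)).comp x (h.contDiffAt hx)
  have := contDiffAt_coord hW
  have := contDiffAt_coord hW'
  have := contDiffAt_coord hW''
  simp only [detg_eq]
  fun_prop

lemma contDiffAt_crossg (h : IsFrontalOn D T G F N) (hx : x ∈ D)
    (hW : ContDiffAt ℝ ∞ W x) (hW' : ContDiffAt ℝ ∞ W' x) :
    ContDiffAt ℝ ∞ (fun x => crossg G (F x) (W x) (W' x)) x := by
  have h1 : ContDiffAt ℝ ∞ (fun x => √((G (F x)).det)) x :=
    (h.metric.contDiffAt_sqrt_det (h.maps x hx)).comp x (h.contDiffAt hx)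
  have h2 : ∀ i j, ContDiffAt ℝ ∞ (fun x => (G (F x))⁻¹ i j) x := fun i j =>
    (h.metric.contDiffAt_inv (h.maps x hx) i j).comp x (h.contDiffAt hx)
  have h3 : ∀ j k, ContDiffAt ℝ ∞ (fun x => W x j * W' x k - W x k * W' x j) x := fun j k =>
    ((contDiffAt_coord hW j).mul (contDiffAt_coord hW' k)).sub
      ((contDiffAt_coord hW k).mul (contDiffAt_coord hW' j))
  rw [contDiffAt_euclidean]
  intro i
  have e : (fun x => crossg G (F x) (W x) (W' x) i) = fun x => √((G (F x)).det) *
      ((G (F x))⁻¹ i 0 * (W x 1 * W' x 2 - W x 2 * W' x 1) +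
        (G (F x))⁻¹ i 1 * (W x 2 * W' x 0 - W x 0 * W' x 2) +
        (G (F x))⁻¹ i 2 * (W x 0 * W' x 1 - W x 1 * W' x 0)) := by
    funext x
    simp [crossg, Matrix.mulVec, dotProduct, Fin.sum_univ_three, cross_apply]
  rw [e]
  exact h1.mul ((((h2 i 0).mul (h3 1 2)).add ((h2 i 1).mul (h3 2 0))).add ((h2 i 2).mul (h3 0 1)))

/-- Compatibility of the connection with the metric. -/
lemma fderiv_ip (h : IsFrontalOn D T G F N) (hx : x ∈ D) (hW : DifferentiableAt ℝ W x)
    (hW' : DifferentiableAt ℝ W' x) :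
    fderiv ℝ (fun x => ip G (F x) (W x) (W' x)) x (X x) =
      ip G (F x) (covDeriv G F X W x) (W' x) + ip G (F x) (W x) (covDeriv G F X W' x) := by
  have hF : HasFDerivAt F (fderiv ℝ F x) x :=
    ((h.contDiffAt hx).differentiableAt (by simp)).hasFDerivAt
  have hGd : ∀ i j, HasFDerivAt (fun x => G (F x) i j)
      ((fderiv ℝ (fun z => G z i j) (F x)).comp (fderiv ℝ F x)) x := fun i j =>
    ((h.metric.contDiffAt_entry (h.maps x hx) i j).differentiableAt (by simp)).hasFDerivAt.comp x hF
  have hc : ∀ {W : E2 → E3}, DifferentiableAt ℝ W x → ∀ i,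
      HasFDerivAt (fun x => W x i) ((EuclideanSpace.proj i).comp (fderiv ℝ W x)) x :=
    fun hW i => (EuclideanSpace.proj i : E3 →L[ℝ] ℝ).hasFDerivAt.comp x
      hW.hasFDerivAt
  have hd : HasFDerivAt (fun x => ip G (F x) (W x) (W' x)) _ x :=
    HasFDerivAt.fun_sum fun i _ => HasFDerivAt.fun_sum fun j _ =>
      ((hGd i j).mul (hc hW i)).mul (hc hW' j)
  have hs := h.metric.sum_fderiv_eq (h.maps x hx) (fderiv ℝ F x (X x)) (W x) (W' x)
  rw [hd.fderiv, covDeriv_eq, covDeriv_eq, ip_add_left, ip_add_right]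
  have e : ∀ p q r s : ℝ, p + q + (r + s) = (p + r) + (q + s) := by intros; ring
  rw [e, ← hs]
  simp only [ip_eq_sum, Fin.sum_univ_three, add_apply, smul_apply, smul_eq_mul, Pi.mul_apply,
    ContinuousLinearMap.comp_apply, PiLp.proj_apply]
  ring

lemma covDeriv_add_left (v w : E2) : covDeriv G F (fun _ => v + w) W x =
    covDeriv G F (fun _ => v) W x + covDeriv G F (fun _ => w) W x := by
  simp only [covDeriv_eq, map_add, christoffelVec_add_left]
  abel

lemma covDeriv_smul_left (r : ℝ) (v : E2) : covDeriv G F (fun _ => r • v) W x =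
    r • covDeriv G F (fun _ => v) W x := by
  simp only [covDeriv_eq, map_smul, christoffelVec_smul_left, smul_add]

/-- The connection is torsion free. -/
lemma covDeriv_fderiv_comm (h : IsFrontalOn D T G F N) (hx : x ∈ D) (v w : E2) :
    covDeriv G F (fun _ => v) (fun x => fderiv ℝ F x w) x =
      covDeriv G F (fun _ => w) (fun x => fderiv ℝ F x v) x := by
  have hd : ∀ w, fderiv ℝ (fun x => fderiv ℝ F x w) x =
      (fderiv ℝ (fderiv ℝ F) x).flip w := by
    intro w
    have := ((ContDiffAt.fderiv_top (h.contDiffAt hx)).differentiableAt (by simp)).hasFDerivAt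
    exact ((ContinuousLinearMap.apply ℝ E3 w).hasFDerivAt.comp x this).fderiv
  have hsymm := (h.contDiffAt hx).isSymmSndFDerivAt (by
    rw [minSmoothness_of_isRCLikeNormedField]
    exact WithTop.coe_le_coe.2 le_top)
  rw [covDeriv_eq, covDeriv_eq, h.metric.christoffelVec_comm (h.maps x hx), hd, hd,
    ContinuousLinearMap.flip_apply, ContinuousLinearMap.flip_apply, hsymm.eq]

/-- The second fundamental form. -/
def sff (G : E3 → Matrix (Fin 3) (Fin 3) ℝ) (F N : E2 → E3) (x v w : E2) : ℝ :=
  -ip G (F x) (fderiv ℝ F x v) (covDeriv G F (fun _ => w) N x)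

lemma contDiffAt_fderiv_apply (h : IsFrontalOn D T G F N) (hx : x ∈ D) (hX : ContDiffAt ℝ ∞ X x) :
    ContDiffAt ℝ ∞ (fun x => fderiv ℝ F x (X x)) x :=
  (ContDiffAt.fderiv_top (h.contDiffAt hx)).clm_apply hX

/-- Differentiate `⟨f_Y, N⟩ = 0`. -/
lemma ip_covDeriv_normal (h : IsFrontalOn D T G F N) (hx : x ∈ D) {Y : E2 → E2}
    (hY : ContDiffAt ℝ ∞ Y x) :
    ip G (F x) (covDeriv G F X (fun x => fderiv ℝ F x (Y x)) x) (N x) =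
      -ip G (F x) (fderiv ℝ F x (Y x)) (covDeriv G F X N x) := by
  have hd := h.fderiv_ip (X := X) hx
    ((h.contDiffAt_fderiv_apply hx hY).differentiableAt (by simp))
    ((h.contDiffAt_normal hx).differentiableAt (by simp))
  have h0 : (fun x => ip G (F x) (fderiv ℝ F x (Y x)) (N x)) =ᶠ[𝓝 x] fun _ => 0 := by
    filter_upwards [h.isOpen.mem_nhds hx] with z hz using h.normal z hz _
  rw [h0.fderiv_eq] at hd
  simp only [fderiv_fun_const, Pi.zero_apply, zero_apply] at hd
  linarith

lemma sff_comm (h : IsFrontalOn D T G F N) (hx : x ∈ D) (v w : E2) :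
    sff G F N x v w = sff G F N x w v := by
  rw [sff, sff, ← h.ip_covDeriv_normal hx (X := fun _ => w) (Y := fun _ => v) contDiffAt_const,
    ← h.ip_covDeriv_normal hx (X := fun _ => v) (Y := fun _ => w) contDiffAt_const,
    h.covDeriv_fderiv_comm hx]

lemma sff_add_left (v v' w : E2) :
    sff G F N x (v + v') w = sff G F N x v w + sff G F N x v' w := by
  simp only [sff, map_add, ip_add_left]
  ring

lemma sff_add_right (v w w' : E2) :
    sff G F N x v (w + w') = sff G F N x v w + sff G F N x v w' := by
  simp only [sff, covDeriv_add_left, ip_add_right]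
  ring

lemma sff_smul_left (r : ℝ) (v w : E2) : sff G F N x (r • v) w = r * sff G F N x v w := by
  simp only [sff, map_smul, ip_smul_left]
  ring

lemma sff_smul_right (r : ℝ) (v w : E2) : sff G F N x v (r • w) = r * sff G F N x v w := by
  simp only [sff, covDeriv_smul_left, ip_smul_right]
  ring

/-- The numerator of the mean curvature, computed with respect to the frame `v, w`. -/
def curvNum (G : E3 → Matrix (Fin 3) (Fin 3) ℝ) (F N : E2 → E3) (v w x : E2) : ℝ :=
  ip G (F x) (fderiv ℝ F x v) (fderiv ℝ F x v) * sff G F N x w w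
    - 2 * ip G (F x) (fderiv ℝ F x v) (fderiv ℝ F x w) * sff G F N x v w
    + ip G (F x) (fderiv ℝ F x w) (fderiv ℝ F x w) * sff G F N x v v

lemma eq_smul_du_add_smul_dv (v : E2) : v = v 0 • du + v 1 • dv := by
  ext i
  fin_cases i <;> simp [du, dv]

/-- The determinant of two vectors of the plane. -/
def det2 (v w : E2) : ℝ := v 0 * w 1 - v 1 * w 0

/-- Both fundamental forms are symmetric and bilinear, so their mixed discriminant scales by the
squared determinant of the frame. This permits computing in a frame adapted to the null direction.
-/
lemma curvNum_eq (h : IsFrontalOn D T G F N) (hx : x ∈ D) (v w : E2) :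
    curvNum G F N v w x = det2 v w ^ 2 * curvNum G F N du dv x := by
  have hs := h.sff_comm hx dv du
  have hi := h.ip_comm hx (fderiv ℝ F x dv) (fderiv ℝ F x du)
  have key : ∀ v0 v1 w0 w1 : ℝ, curvNum G F N (v0 • du + v1 • dv) (w0 • du + w1 • dv) x =
      (v0 * w1 - v1 * w0) ^ 2 * curvNum G F N du dv x := by
    intro v0 v1 w0 w1
    simp only [curvNum, map_add, map_smul, ip_add_left, ip_add_right, ip_smul_left, ip_smul_right,
      sff_add_left, sff_add_right, sff_smul_left, sff_smul_right, hs, hi]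
    ring
  have := key (v 0) (v 1) (w 0) (w 1)
  rwa [← eq_smul_du_add_smul_dv, ← eq_smul_du_add_smul_dv] at this

end IsFrontalOn

namespace IsFrontalOn

variable {D : Set E2} {T : Set E3} {G : E3 → Matrix (Fin 3) (Fin 3) ℝ} {F N : E2 → E3} {x : E2}

/-! ### The singular set -/

lemma detg_normal_eq (v w : E2) :
    detg G (F x) (fderiv ℝ F x v) (fderiv ℝ F x w) (N x) = det2 v w * signedArea G F N x := by
  have key : ∀ v0 v1 w0 w1 : ℝ, detg G (F x) (fderiv ℝ F x (v0 • du + v1 • dv))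
      (fderiv ℝ F x (w0 • du + w1 • dv)) (N x) = (v0 * w1 - v1 * w0) * signedArea G F N x := by
    intro v0 v1 w0 w1
    simp only [signedArea, detg_eq, map_add, map_smul, PiLp.add_apply, PiLp.smul_apply, smul_eq_mul]
    ring
  have := key (v 0) (v 1) (w 0) (w 1)
  rwa [← eq_smul_du_add_smul_dv, ← eq_smul_du_add_smul_dv] at this

lemma ip_mul_ip_sub_sq (h : IsFrontalOn D T G F N) (hx : x ∈ D) :
    ip G (F x) (fderiv ℝ F x du) (fderiv ℝ F x du) * ip G (F x) (fderiv ℝ F x dv) (fderiv ℝ F x dv)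
      - ip G (F x) (fderiv ℝ F x du) (fderiv ℝ F x dv) ^ 2 = signedArea G F N x ^ 2 :=
  FrontalGeometry.ip_mul_ip_sub_sq (h.metric.symm _ (h.maps x hx)) (h.metric.pos _ (h.maps x hx))
    (h.unit x hx) (h.normal x hx _) (h.normal x hx _)

lemma eq_zero_of_ip_self_eq_zero (h : IsFrontalOn D T G F N) (hx : x ∈ D) {a : E3}
    (ha : ip G (F x) a a = 0) : a = 0 := by
  by_contra hne
  exact (h.metric.pos _ (h.maps x hx) a hne).ne' ha

lemma exists_fderiv_eq_zero (h : IsFrontalOn D T G F N) (hx : x ∈ D)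
    (hl : signedArea G F N x = 0) : ∃ w, w ≠ 0 ∧ fderiv ℝ F x w = 0 := by
  have hsq := h.ip_mul_ip_sub_sq hx
  by_cases hE : ip G (F x) (fderiv ℝ F x du) (fderiv ℝ F x du) = 0
  · refine ⟨du, ?_, h.eq_zero_of_ip_self_eq_zero hx hE⟩
    intro h0
    have : du 0 = 0 := by rw [h0]; rfl
    simp [du] at this
  -- With `E = ⟨f_u, f_u⟩`, the image of this vector has squared length `E` times the Gram
  -- determinant, which is zero here; its `dv` component `-E` is not zero.
  · refine ⟨ip G (F x) (fderiv ℝ F x du) (fderiv ℝ F x dv) • du -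
      ip G (F x) (fderiv ℝ F x du) (fderiv ℝ F x du) • dv, ?_, h.eq_zero_of_ip_self_eq_zero hx ?_⟩
    · intro h0
      have := congrArg (fun v : E2 => v 1) h0
      exact hE (by simpa [du, dv] using this)
    · rw [hl] at hsq
      simp only [sub_eq_add_neg, ← neg_smul, map_add, map_smul, ip_add_left, ip_add_right,
        ip_smul_left, ip_smul_right, h.ip_comm hx (fderiv ℝ F x dv) (fderiv ℝ F x du)]
      linear_combination ip G (F x) (fderiv ℝ F x du) (fderiv ℝ F x du) * hsq

lemma exists_det2_ne_zero {w : E2} (hw : w ≠ 0) : ∃ v, det2 v w ≠ 0 := by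
  refine ⟨!₂[w 1, -w 0], fun h => hw ?_⟩
  have h1 : w 1 * w 1 + w 0 * w 0 = 0 := by simpa [det2] using h
  ext i
  fin_cases i
  · show w 0 = 0
    nlinarith [mul_self_nonneg (w 0), mul_self_nonneg (w 1)]
  · show w 1 = 0
    nlinarith [mul_self_nonneg (w 0), mul_self_nonneg (w 1)]

lemma injective_iff (h : IsFrontalOn D T G F N) (hx : x ∈ D) :
    Function.Injective (fderiv ℝ F x) ↔ signedArea G F N x ≠ 0 := by
  constructor
  · intro hi hl
    obtain ⟨w, hw, hFw⟩ := h.exists_fderiv_eq_zero hx hl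
    exact hw (hi (hFw.trans (map_zero _).symm))
  · intro hl
    rw [injective_iff_map_eq_zero]
    intro w hFw
    by_contra hw
    obtain ⟨v, hv⟩ := exists_det2_ne_zero hw
    have := detg_normal_eq (G := G) (F := F) (N := N) (x := x) v w
    rw [hFw] at this
    refine mul_ne_zero hv hl (this.symm.trans ?_)
    simp [detg_eq]

lemma regularSet_eq (h : IsFrontalOn D T G F N) :
    regularSet D F = {x | x ∈ D ∧ signedArea G F N x ≠ 0} := by
  ext x
  exact and_congr_right fun hx => h.injective_iff hx

lemma signedArea_eq_zero (h : IsFrontalOn D T G F N) (hx : x ∈ singularSet D F) :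
    signedArea G F N x = 0 := by
  by_contra hne
  exact hx.2 ((h.injective_iff hx.1).2 hne)

/-- In a frame `v, w` with `w` null, each of the three terms contains `f_w`. -/
lemma curvNum_eq_zero (h : IsFrontalOn D T G F N) (hx : x ∈ D) (hl : signedArea G F N x = 0) :
    curvNum G F N du dv x = 0 := by
  obtain ⟨w, hw, hFw⟩ := h.exists_fderiv_eq_zero hx hl
  obtain ⟨v, hv⟩ := exists_det2_ne_zero hw
  have := h.curvNum_eq hx v w
  rw [curvNum, sff, hFw] at this
  simp only [ip_zero_left, ip_zero_right] at this
  have h2 : det2 v w ^ 2 * curvNum G F N du dv x = 0 := by linarith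
  exact (mul_eq_zero.1 h2).resolve_left (pow_ne_zero 2 hv)

lemma meanCurvature_eq (h : IsFrontalOn D T G F N) (hx : x ∈ D) :
    meanCurvature G F N x = curvNum G F N du dv x / (2 * signedArea G F N x ^ 2) := by
  rw [← h.ip_mul_ip_sub_sq hx]
  rfl

lemma contDiffAt_signedArea (h : IsFrontalOn D T G F N) (hx : x ∈ D) :
    ContDiffAt ℝ ∞ (signedArea G F N) x :=
  h.contDiffAt_detg hx (h.contDiffAt_fderiv_apply hx contDiffAt_const)
    (h.contDiffAt_fderiv_apply hx contDiffAt_const) (h.contDiffAt_normal hx)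

lemma contDiffAt_sff (h : IsFrontalOn D T G F N) (hx : x ∈ D) (v w : E2) :
    ContDiffAt ℝ ∞ (fun x => sff G F N x v w) x :=
  (h.contDiffAt_ip hx (h.contDiffAt_fderiv_apply hx contDiffAt_const)
    (h.contDiffAt_covDeriv hx contDiffAt_const (h.contDiffAt_normal hx))).neg

lemma contDiffAt_curvNum (h : IsFrontalOn D T G F N) (hx : x ∈ D) (v w : E2) :
    ContDiffAt ℝ ∞ (curvNum G F N v w) x := by
  have hi : ∀ v w : E2, ContDiffAt ℝ ∞ (fun x => ip G (F x) (fderiv ℝ F x v) (fderiv ℝ F x w)) x :=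
    fun v w => h.contDiffAt_ip hx (h.contDiffAt_fderiv_apply hx contDiffAt_const)
      (h.contDiffAt_fderiv_apply hx contDiffAt_const)
  exact (((hi v v).mul (h.contDiffAt_sff hx w w)).sub
    ((contDiffAt_const.mul (hi v w)).mul (h.contDiffAt_sff hx v w))).add
    ((hi w w).mul (h.contDiffAt_sff hx v v))

lemma isSquareQuotient (h : IsFrontalOn D T G F N) (hnd : IsNondegenerate D G F N) :
    IsSquareQuotient D (signedArea G F N) (curvNum G F N du dv) (meanCurvature G F N) where
  isOpen := h.isOpen
  zero_mem := hnd.1.1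
  smooth_lam := fun _ hx => (h.contDiffAt_signedArea hx).contDiffWithinAt
  smooth_num := fun _ hx => (h.contDiffAt_curvNum hx du dv).contDiffWithinAt
  lam_zero := h.signedArea_eq_zero hnd.1
  fderiv_ne := hnd.2
  num_zero := fun _ hx hl => h.curvNum_eq_zero hx hl
  eq := fun _ hx _ => h.meanCurvature_eq hx

/-! ### Derivatives at a singular point in the null direction -/

variable {η : E2 → E2}

lemma fderiv_ip_of_eq_zero {W W' : E2 → E3} (h : IsFrontalOn D T G F N) (hx : x ∈ D)
    (hW : ContDiffAt ℝ ∞ W x) (hW' : ContDiffAt ℝ ∞ W' x) (h0 : W x = 0) :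
    fderiv ℝ (fun x => ip G (F x) (W x) (W' x)) x (η x) =
      ip G (F x) (covDeriv G F η W x) (W' x) := by
  rw [h.fderiv_ip hx (hW.differentiableAt (by simp)) (hW'.differentiableAt (by simp)), h0,
    ip_zero_left, add_zero]

lemma contDiffAt_fEta (h : IsFrontalOn D T G F N) (hx : x ∈ D) (hη : ContDiffAt ℝ ∞ η x) :
    ContDiffAt ℝ ∞ (fEta F η) x :=
  h.contDiffAt_fderiv_apply hx hη

lemma contDiffAt_fEta2 (h : IsFrontalOn D T G F N) (hx : x ∈ D) (hη : ContDiffAt ℝ ∞ η x) :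
    ContDiffAt ℝ ∞ (fEta2 G F η) x :=
  h.contDiffAt_covDeriv hx hη (h.contDiffAt_fEta hx hη)

lemma contDiffAt_covDeriv_normal (h : IsFrontalOn D T G F N) (hx : x ∈ D)
    (hη : ContDiffAt ℝ ∞ η x) : ContDiffAt ℝ ∞ (covDeriv G F η N) x :=
  h.contDiffAt_covDeriv hx hη (h.contDiffAt_normal hx)

lemma ip_fEta2_normal (h : IsFrontalOn D T G F N) (hx : x ∈ D) (hη : ContDiffAt ℝ ∞ η x) :
    ip G (F x) (fEta2 G F η x) (N x) = -ip G (F x) (fEta F η x) (covDeriv G F η N x) :=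
  h.ip_covDeriv_normal hx hη

variable {V : Set E2}

/-- Differentiate `⟨f_ηη, N⟩ = -⟨f_η, ∇_η N⟩` along `η`. Where `f_η = 0`, each side produces one
copy of `⟨f_ηη, ∇_η N⟩`, whence the factor 2. -/
lemma ip_fEta3_normal (h : IsFrontalOn D T G F N) (hV : IsOpen V) (hVD : V ⊆ D)
    (hη : ContDiffOn ℝ ∞ η V) (hx : x ∈ V) (h0 : fEta F η x = 0) :
    ip G (F x) (N x) (fEta3 G F η x) =
      -2 * ip G (F x) (fEta2 G F η x) (covDeriv G F η N x) := by
  have hxη : ContDiffAt ℝ ∞ η x := hη.contDiffAt (hV.mem_nhds hx)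
  have e : (fun x => ip G (F x) (fEta2 G F η x) (N x)) =ᶠ[𝓝 x]
      fun x => -ip G (F x) (fEta F η x) (covDeriv G F η N x) := by
    filter_upwards [hV.mem_nhds hx] with z hz
    exact h.ip_fEta2_normal (hVD hz) (hη.contDiffAt (hV.mem_nhds hz))
  have h1 := h.fderiv_ip (X := η) (hVD hx)
    ((h.contDiffAt_fEta2 (hVD hx) hxη).differentiableAt (by simp))
    ((h.contDiffAt_normal (hVD hx)).differentiableAt (by simp))
  rw [e.fderiv_eq, fderiv_fun_neg, neg_apply,
    h.fderiv_ip_of_eq_zero (hVD hx) (h.contDiffAt_fEta (hVD hx) hxη)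
      (h.contDiffAt_covDeriv_normal (hVD hx) hxη) h0] at h1
  rw [h.ip_comm (hVD hx)]
  change _ = ip G (F x) (fEta3 G F η x) (N x) + _ at h1
  change -ip G (F x) (fEta2 G F η x) _ = _ at h1
  linarith

lemma contDiffAt_det2 (a : E2) (hη : ContDiffAt ℝ ∞ η x) :
    ContDiffAt ℝ ∞ (fun x => det2 a (η x)) x :=
  (contDiffAt_const.mul (contDiffAt_coord hη 1)).sub (contDiffAt_const.mul (contDiffAt_coord hη 0))

/-- Differentiate `det2 a η · λ = det(f_a, f_η, N)` along `η`. Writing the right side as an inner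
product with `f_η`, which vanishes at `x`, leaves only the derivative of `f_η`. -/
lemma fderiv_signedArea_null (h : IsFrontalOn D T G F N) (hx : x ∈ D)
    (hη : ContDiffAt ℝ ∞ η x) (h0 : fEta F η x = 0) (a : E2) :
    det2 a (η x) * fderiv ℝ (signedArea G F N) x (η x) =
      detg G (F x) (fderiv ℝ F x a) (fEta2 G F η x) (N x) := by
  -- The product rule also yields `λ` times the derivative of `det2 a η` in the direction `η x`; it
  -- vanishes in either case.
  have hl : signedArea G F N x = 0 ∨ η x = 0 := by
    by_cases hl : signedArea G F N x = 0
    · exact Or.inl hl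
    · exact Or.inr ((h.injective_iff hx).2 hl (h0.trans (map_zero _).symm))
  have hd : ∀ᶠ z in 𝓝 x, z ∈ D := h.isOpen.mem_nhds hx
  have hpt : ∀ z ∈ D, det2 a (η z) * signedArea G F N z =
      -ip G (F z) (fEta F η z) (crossg G (F z) (fderiv ℝ F z a) (N z)) := by
    intro z hz
    rw [h.ip_comm hz, ip_crossg (h.metric.symm _ (h.maps z hz)) (h.metric.pos _ (h.maps z hz)),
      detg_swap_right, neg_neg, ← detg_normal_eq]
    rfl
  have e : (fun z => det2 a (η z) * signedArea G F N z) =ᶠ[𝓝 x]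
      fun z => -ip G (F z) (fEta F η z) (crossg G (F z) (fderiv ℝ F z a) (N z)) :=
    hd.mono hpt
  have h1 := e.fderiv_eq (𝕜 := ℝ)
  rw [fderiv_fun_neg, fderiv_fun_mul ((contDiffAt_det2 a hη).differentiableAt (by simp))
    ((h.contDiffAt_signedArea hx).differentiableAt (by simp))] at h1
  have h2 := congrArg (fun l : E2 →L[ℝ] ℝ => l (η x)) h1
  simp only [add_apply, smul_apply, smul_eq_mul, neg_apply] at h2
  rw [h.fderiv_ip_of_eq_zero hx (h.contDiffAt_fEta hx hη)
    (h.contDiffAt_crossg hx (h.contDiffAt_fderiv_apply hx contDiffAt_const)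
      (h.contDiffAt_normal hx)) h0, h.ip_comm hx,
    ip_crossg (h.metric.symm _ (h.maps x hx)) (h.metric.pos _ (h.maps x hx)), detg_swap_right,
    neg_neg] at h2
  rcases hl with hl | hl
  · rw [hl, zero_mul, add_zero] at h2
    exact h2
  · simp only [hl, map_zero, mul_zero, add_zero] at h2 ⊢
    exact h2

/-- Expand the numerator in the frame `a, η` and differentiate along `η`. The terms `⟨f_η, f_a⟩⟨f_a,
∇_η N⟩` and `⟨f_η, f_η⟩` vanish to second order at `x`, so only the derivative of `⟨f_η, ∇_η N⟩`
survives. -/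
lemma fderiv_curvNum_null (h : IsFrontalOn D T G F N) (hx : x ∈ D)
    (hη : ContDiffAt ℝ ∞ η x) (hx0 : signedArea G F N x = 0) (h0 : fEta F η x = 0) (a : E2) :
    det2 a (η x) ^ 2 * fderiv ℝ (curvNum G F N du dv) x (η x) =
      -ip G (F x) (fderiv ℝ F x a) (fderiv ℝ F x a) *
        ip G (F x) (fEta2 G F η x) (covDeriv G F η N x) := by
  have hFa : ContDiffAt ℝ ∞ (fun x => fderiv ℝ F x a) x :=
    h.contDiffAt_fderiv_apply hx contDiffAt_const
  have hFη := h.contDiffAt_fEta hx hη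
  have hNη := h.contDiffAt_covDeriv_normal hx hη
  have dP := ((h.contDiffAt_ip hx hFa hFa).differentiableAt (by simp)).hasFDerivAt
  have dQ := ((h.contDiffAt_ip hx hFη hNη).differentiableAt (by simp)).hasFDerivAt
  have dR := ((h.contDiffAt_ip hx hFη hFa).differentiableAt (by simp)).hasFDerivAt
  have dS := ((h.contDiffAt_ip hx hFa hNη).differentiableAt (by simp)).hasFDerivAt
  have dT := ((h.contDiffAt_ip hx hFη hFη).differentiableAt (by simp)).hasFDerivAt
  have dU := ((h.contDiffAt_sff hx a a).differentiableAt (by simp)).hasFDerivAt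
  have dd := ((contDiffAt_det2 a hη).differentiableAt (by simp)).hasFDerivAt
  have dn := ((h.contDiffAt_curvNum hx du dv).differentiableAt (by simp)).hasFDerivAt
  -- By symmetry of the second fundamental form this equals `⟨f_η, ∇_a N⟩`.
  have hS0 : ip G (F x) (fderiv ℝ F x a) (covDeriv G F η N x) = 0 := by
    have h1 := h.sff_comm hx a (η x)
    have h2 : fderiv ℝ F x (η x) = 0 := h0
    rw [sff, sff, h2, ip_zero_left, neg_zero, neg_eq_zero] at h1
    exact h1
  have hn0 := h.curvNum_eq_zero hx hx0
  have e : (fun z => det2 a (η z) * det2 a (η z) * curvNum G F N du dv z) =ᶠ[𝓝 x] fun z =>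
      2 * (ip G (F z) (fEta F η z) (fderiv ℝ F z a) *
        ip G (F z) (fderiv ℝ F z a) (covDeriv G F η N z)) -
      ip G (F z) (fderiv ℝ F z a) (fderiv ℝ F z a) * ip G (F z) (fEta F η z) (covDeriv G F η N z) +
      ip G (F z) (fEta F η z) (fEta F η z) * sff G F N z a a := by
    filter_upwards [h.isOpen.mem_nhds hx] with z hz
    rw [← sq, ← h.curvNum_eq hz a (η z), curvNum, h.ip_comm hz (fderiv ℝ F z a) (fderiv ℝ F z (η z))]
    change _ * (-ip G (F z) (fEta F η z) (covDeriv G F η N z)) - 2 * _ *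
      (-ip G (F z) (fderiv ℝ F z a) (covDeriv G F η N z)) + _ = _
    simp only [fEta]
    ring
  have hL := ((dd.mul dd).mul dn).congr_of_eventuallyEq e.symm
  have hR := (((dR.mul dS).const_mul (2 : ℝ)).sub (dP.mul dQ)).add (dT.mul dU)
  have h1 := congrArg (fun l : E2 →L[ℝ] ℝ => l (η x)) (hL.unique hR)
  simp only [add_apply, sub_apply, smul_apply, smul_eq_mul, Pi.mul_apply,
    h.fderiv_ip_of_eq_zero hx hFη hNη h0, h.fderiv_ip_of_eq_zero hx hFη hFa h0,
    h.fderiv_ip_of_eq_zero hx hFη hFη h0, hS0, hn0, h0, ip_zero_left, ip_zero_right] at h1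
  change _ = 2 * (0 * _ + _) - (_ * ip G (F x) (fEta2 G F η x) (covDeriv G F η N x) + _) + _ at h1
  linarith

end IsFrontalOn

namespace IsFrontalOn

variable {D : Set E2} {T : Set E3} {G : E3 → Matrix (Fin 3) (Fin 3) ℝ} {F N : E2 → E3} {x : E2}
  {η : E2 → E2} {V : Set E2} {γ : ℝ → E2} {ε t : ℝ}

/-! ### The cuspidal curvature -/

/-- The ratio of the cuspidal curvature to the derivative of the numerator of the mean curvature in
the null direction. -/
def cuspFactor (G : E3 → Matrix (Fin 3) (Fin 3) ℝ) (F N : E2 → E3) (γ : ℝ → E2) (η : E2 → E2)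
    (t : ℝ) : ℝ :=
  let S := len G (F (γ t)) (fderiv ℝ F (γ t) (deriv γ t))
  -- Where `f_η = 0` this is `det_g(f∘γ', f_ηη, ν)`, by `fderiv_signedArea_null`.
  let δ := det2 (deriv γ t) (η (γ t)) * fderiv ℝ (signedArea G F N) (γ t) (η (γ t))
  S ^ (3 / 2 : ℝ) * (δ * (2 * det2 (deriv γ t) (η (γ t)) ^ 2 / S ^ 2)) / |δ| ^ (5 / 2 : ℝ)

lemma fderiv_deriv_ne_zero (h : IsFrontalOn D T G F N) (hx : x ∈ D) (hη : ContDiffAt ℝ ∞ η x)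
    (h0 : fEta F η x = 0) {a : E2} (hd : det2 a (η x) ≠ 0)
    (hl : fderiv ℝ (signedArea G F N) x (η x) ≠ 0) : fderiv ℝ F x a ≠ 0 := by
  intro ha
  have := h.fderiv_signedArea_null hx hη h0 a
  rw [ha] at this
  exact mul_ne_zero hd hl (this.trans (by simp [detg_eq]))

lemma len_pos (h : IsFrontalOn D T G F N) (hx : x ∈ D) {a : E3} (ha : a ≠ 0) :
    0 < len G (F x) a :=
  Real.sqrt_pos.2 (h.metric.pos _ (h.maps x hx) a ha)

/-- Since `f_ηη` is orthogonal to the normal on the singular curve, the triple determinant splits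
off `⟨N, f_ηηη⟩` and the vector product has length `|δ|`. Both `q` and `⟨N, f_ηηη⟩` are multiples of
`⟨f_ηη, ∇_η N⟩`. -/
lemma cuspidalCurvature_eq (h : IsFrontalOn D T G F N) (hV : IsOpen V) (hVD : V ⊆ D)
    (hη : ContDiffOn ℝ ∞ η V) (hγ : DifferentiableAt ℝ γ t) (ht : γ t ∈ V)
    (hs : signedArea G F N (γ t) = 0) (h0 : fEta F η (γ t) = 0)
    (hd : det2 (deriv γ t) (η (γ t)) ≠ 0)
    (hl : fderiv ℝ (signedArea G F N) (γ t) (η (γ t)) ≠ 0) :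
    cuspidalCurvature G F γ η t =
      cuspFactor G F N γ η t * fderiv ℝ (curvNum G F N du dv) (γ t) (η (γ t)) := by
  have hD := hVD ht
  have hηt : ContDiffAt ℝ ∞ η (γ t) := hη.contDiffAt (hV.mem_nhds ht)
  have hFγ : deriv (F ∘ γ) t = fderiv ℝ F (γ t) (deriv γ t) :=
    (HasFDerivAt.comp_hasDerivAt t ((h.contDiffAt hD).differentiableAt (by simp)).hasFDerivAt
      hγ.hasDerivAt).deriv
  have hFa := h.fderiv_deriv_ne_zero hD hηt h0 hd hl
  have hδ := h.fderiv_signedArea_null hD hηt h0 (deriv γ t)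
  have hq := h.fderiv_curvNum_null hD hηt hs h0 (deriv γ t)
  have hsymm := h.metric.symm _ (h.maps _ hD)
  have hpos := h.metric.pos _ (h.maps _ hD)
  have hZ : ip G (F (γ t)) (fEta2 G F η (γ t)) (N (γ t)) = 0 := by
    rw [h.ip_fEta2_normal hD hηt, h0, ip_zero_left, neg_zero]
  have hdet := detg_eq_mul_ip hsymm hpos (h.unit _ hD) (h.normal _ hD (deriv γ t)) hZ
    (fEta3 G F η (γ t))
  have hlen := len_crossg hsymm hpos (h.unit _ hD) (h.normal _ hD (deriv γ t)) hZ
  have hS := h.len_pos hD hFa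
  have hS2 : len G (F (γ t)) (fderiv ℝ F (γ t) (deriv γ t)) ^ 2 =
      ip G (F (γ t)) (fderiv ℝ F (γ t) (deriv γ t)) (fderiv ℝ F (γ t) (deriv γ t)) :=
    Real.sq_sqrt (hpos _ hFa).le
  rw [← hS2] at hq
  simp only [cuspidalCurvature, speed, cuspFactor, hFγ, hlen, hdet, ← hδ,
    h.ip_fEta3_normal hV hVD hη ht h0]
  set S := len G (F (γ t)) (fderiv ℝ F (γ t) (deriv γ t))
  have key : -2 * ip G (F (γ t)) (fEta2 G F η (γ t)) (covDeriv G F η N (γ t)) =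
      2 * det2 (deriv γ t) (η (γ t)) ^ 2 / S ^ 2 *
        fderiv ℝ (curvNum G F N du dv) (γ t) (η (γ t)) := by
    field_simp
    linear_combination -hq
  rw [key]
  ring

lemma cuspFactor_ne_zero (h : IsFrontalOn D T G F N) (hD : γ t ∈ D)
    (hη : ContDiffAt ℝ ∞ η (γ t)) (h0 : fEta F η (γ t) = 0)
    (hd : det2 (deriv γ t) (η (γ t)) ≠ 0)
    (hl : fderiv ℝ (signedArea G F N) (γ t) (η (γ t)) ≠ 0) : cuspFactor G F N γ η t ≠ 0 := by
  have hS := h.len_pos hD (h.fderiv_deriv_ne_zero hD hη h0 hd hl)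
  have hδ := mul_ne_zero hd hl
  have h1 : 0 < len G (F (γ t)) (fderiv ℝ F (γ t) (deriv γ t)) ^ (3 / 2 : ℝ) :=
    Real.rpow_pos_of_pos hS _
  have h2 := Real.rpow_pos_of_pos (abs_pos.2 hδ) (5 / 2 : ℝ)
  simp only [cuspFactor]
  refine div_ne_zero (mul_ne_zero h1.ne' (mul_ne_zero hδ ?_)) h2.ne'
  positivity

lemma continuousAt_len {c W : ℝ → E3} (hG : ∀ i j, ContinuousAt (fun t => G (c t) i j) t)
    (hW : ContinuousAt W t) : ContinuousAt (fun t => len G (c t) (W t)) t := by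
  refine ContinuousAt.sqrt ?_
  simp only [ip_eq_sum]
  have hW' : ∀ i, ContinuousAt (fun t => W t i) t := fun i => by fun_prop
  have h2 : ∀ i j, ContinuousAt (fun t => G (c t) i j * W t i * W t j) t := fun i j =>
    ((hG i j).mul (hW' i)).mul (hW' j)
  exact (((h2 0 0).add (h2 0 1)).add (h2 0 2)).add (((h2 1 0).add (h2 1 1)).add (h2 1 2)) |>.add
    (((h2 2 0).add (h2 2 1)).add (h2 2 2))

lemma continuousAt_cuspFactor (h : IsFrontalOn D T G F N) (hD : γ t ∈ D)
    (hη : ContDiffAt ℝ ∞ η (γ t)) (hγ : ContDiffAt ℝ ∞ γ t) (h0 : fEta F η (γ t) = 0)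
    (hd : det2 (deriv γ t) (η (γ t)) ≠ 0)
    (hl : fderiv ℝ (signedArea G F N) (γ t) (η (γ t)) ≠ 0) :
    ContinuousAt (cuspFactor G F N γ η) t := by
  have hS := h.len_pos hD (h.fderiv_deriv_ne_zero hD hη h0 hd hl)
  have hδ := mul_ne_zero hd hl
  have hcγ := hγ.continuousAt
  have hγ' : ContinuousAt (deriv γ) t :=
    tendsto_clm_apply (ContDiffAt.fderiv_top hγ).continuousAt (tendsto_const_nhds (x := (1 : ℝ)))
  have hcη : ContinuousAt (fun t => η (γ t)) t := ContinuousAt.comp (g := η) hη.continuousAt hcγ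
  have hcl : ContinuousAt (fun t => fderiv ℝ (signedArea G F N) (γ t) (η (γ t))) t :=
    tendsto_clm_apply (ContinuousAt.comp (g := fderiv ℝ (signedArea G F N))
      (ContDiffAt.fderiv_top (h.contDiffAt_signedArea hD)).continuousAt hcγ) hcη
  have hcF : ContinuousAt (fun t => fderiv ℝ F (γ t) (deriv γ t)) t :=
    tendsto_clm_apply (ContinuousAt.comp (g := fderiv ℝ F)
      (ContDiffAt.fderiv_top (h.contDiffAt hD)).continuousAt hcγ) hγ'
  have hcG : ∀ i j, ContinuousAt (fun t => G (F (γ t)) i j) t := fun i j =>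
    ContinuousAt.comp (g := fun x => G (F x) i j) (h.contDiffAt_entry hD i j).continuousAt hcγ
  have hcd : ContinuousAt (fun t => det2 (deriv γ t) (η (γ t))) t := by
    unfold det2
    fun_prop
  have hcS : ContinuousAt (fun t => len G (F (γ t)) (fderiv ℝ F (γ t) (deriv γ t))) t :=
    continuousAt_len hcG hcF
  exact ((hcS.rpow_const (Or.inl hS.ne')).mul ((hcd.mul hcl).mul
    ((continuousAt_const.mul (hcd.pow 2)).div (hcS.pow 2) (pow_ne_zero 2 hS.ne')))).div
    ((hcd.mul hcl).abs.rpow_const (Or.inl (abs_pos.2 hδ).ne'))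
    (Real.rpow_pos_of_pos (abs_pos.2 hδ) _).ne'

/-- At a zero of `q` the slope of `K q` is `K` times the slope of `q`. Thus `cuspFactor`, with its
fractional powers, need only be continuous. -/
lemma hasDerivAt_mul_of_eq_zero {K q : ℝ → ℝ} {q' t : ℝ} (hK : ContinuousAt K t)
    (hq : HasDerivAt q q' t) (h0 : q t = 0) : HasDerivAt (fun t => K t * q t) (K t * q') t := by
  rw [hasDerivAt_iff_tendsto_slope] at hq ⊢
  refine ((hK.tendsto.mono_left nhdsWithin_le_nhds).mul hq).congr fun s => ?_
  simp only [slope_def_field, h0]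
  ring

lemma exists_eq_smul_add_smul {a b : E2} (hab : det2 a b ≠ 0) (x : E2) :
    ∃ α β : ℝ, x = α • a + β • b := by
  refine ⟨det2 x b / det2 a b, det2 a x / det2 a b, ?_⟩
  ext i
  rw [PiLp.add_apply, PiLp.smul_apply, PiLp.smul_apply, smul_eq_mul, smul_eq_mul,
    div_mul_eq_mul_div, div_mul_eq_mul_div, ← add_div, eq_div_iff hab]
  fin_cases i <;> simp only [det2, Fin.zero_eta, Fin.mk_one] <;> ring

/-- The criteria for the mean curvature near a singular point, in coordinates. -/
theorem meanCurvature_criteria (h : IsFrontalOn D T G F N) (hnd : IsNondegenerate D G F N)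
    (hγ : IsSingularCurve D F ε γ) (hη : IsExtendedNullField D F ε γ V η) :
    (BoundedNear D (regularSet D F) (meanCurvature G F N) ↔
      ∀ᶠ t in 𝓝 (0 : ℝ), cuspidalCurvature G F γ η t = 0) ∧
    (RationallyBounded D (regularSet D F) (meanCurvature G F N) ↔
      cuspidalCurvature G F γ η 0 = 0) ∧
    (RationallyContinuous D (regularSet D F) (meanCurvature G F N) ↔
      cuspidalCurvature G F γ η 0 = 0 ∧ derivateCuspidalCurvature G F γ η = 0) := by
  have hsq := h.isSquareQuotient hnd
  have hmem0 : (0 : ℝ) ∈ Ioo (-ε) ε := ⟨neg_lt_zero.2 hγ.pos, hγ.pos⟩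
  have hI : ∀ᶠ t in 𝓝 (0 : ℝ), t ∈ Ioo (-ε) ε := isOpen_Ioo.mem_nhds hmem0
  have hγs : ∀ t ∈ Ioo (-ε) ε, ContDiffAt ℝ ∞ γ t := fun t ht =>
    hγ.smooth.contDiffAt (isOpen_Ioo.mem_nhds ht)
  have hγ0 := hγs 0 hmem0
  have hlγ : ∀ t ∈ Ioo (-ε) ε, signedArea G F N (γ t) = 0 := fun t ht =>
    h.signedArea_eq_zero (hγ.mem t ht)
  have hlγ' : ∀ᶠ t in 𝓝 (0 : ℝ), signedArea G F N (γ t) = 0 := hI.mono hlγ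
  have hηs : ∀ x ∈ V, ContDiffAt ℝ ∞ η x := fun x hx =>
    hη.smooth.contDiffAt (hη.isOpen.mem_nhds hx)
  have hVt : ∀ᶠ t in 𝓝 (0 : ℝ), γ t ∈ V :=
    hγ0.continuousAt.eventually (hη.isOpen.mem_nhds (by rw [hγ.zero]; exact hη.zero_mem))
  have hγV0 : γ 0 ∈ V := by rw [hγ.zero]; exact hη.zero_mem
  have hdet : ∀ t ∈ Ioo (-ε) ε, γ t ∈ V → det2 (deriv γ t) (η (γ t)) ≠ 0 := by
    intro t ht hV
    have := hη.positive t ht hV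
    rw [Matrix.det_fin_two] at this
    exact this.ne'
  have hb : ContDiffAt ℝ ∞ (fun t => η (γ t)) 0 := (hηs _ hγV0).comp (0 : ℝ) hγ0
  have hspan := exists_eq_smul_add_smul (hdet 0 hmem0 hγV0)
  have hl0 : fderiv ℝ (signedArea G F N) (γ 0) (η (γ 0)) ≠ 0 := by
    have := hsq.fderiv_lam_ne_zero (hγ0.differentiableAt (by simp)) hγ.zero hlγ' hspan
    rwa [hγ.zero] at this ⊢
  have hcl : ContinuousAt (fun t => fderiv ℝ (signedArea G F N) (γ t) (η (γ t))) 0 :=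
    tendsto_clm_apply (ContinuousAt.comp (g := fderiv ℝ (signedArea G F N))
      (ContDiffAt.fderiv_top (h.contDiffAt_signedArea (hη.subset hγV0))).continuousAt
      hγ0.continuousAt) hb.continuousAt
  have hlt : ∀ᶠ t in 𝓝 (0 : ℝ), fderiv ℝ (signedArea G F N) (γ t) (η (γ t)) ≠ 0 :=
    hcl.eventually_ne hl0
  have hκ : ∀ᶠ t in 𝓝 (0 : ℝ), cuspFactor G F N γ η t ≠ 0 ∧ cuspidalCurvature G F γ η t =
      cuspFactor G F N γ η t * fderiv ℝ (curvNum G F N du dv) (γ t) (η (γ t)) := by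
    filter_upwards [hI, hVt, hlt] with t ht hV hl
    exact ⟨h.cuspFactor_ne_zero (hη.subset hV) (hηs _ hV) (hη.null t ht hV) (hdet t ht hV) hl,
      h.cuspidalCurvature_eq hη.isOpen hη.subset hη.smooth ((hγs t ht).differentiableAt (by simp))
        hV (hlγ t ht) (hη.null t ht hV) (hdet t ht hV) hl⟩
  have hκ0 := hκ.self_of_nhds
  have hzero : cuspidalCurvature G F γ η 0 = 0 ↔
      fderiv ℝ (curvNum G F N du dv) (γ 0) (η (γ 0)) = 0 := by
    rw [hκ0.2, mul_eq_zero, or_iff_right hκ0.1]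
  have hKc := h.continuousAt_cuspFactor (hη.subset hγV0) (hηs _ hγV0) hγ0
    (hη.null 0 hmem0 hγV0) (hdet 0 hmem0 hγV0) hl0
  have hqd : DifferentiableAt ℝ
      (fun t => fderiv ℝ (curvNum G F N du dv) (γ t) (η (γ t))) 0 := by
    have h1 : ContDiffAt ℝ ∞ (fun t => fderiv ℝ (curvNum G F N du dv) (γ t)) 0 :=
      (ContDiffAt.fderiv_top (h.contDiffAt_curvNum (hη.subset hγV0) du dv)).comp (0 : ℝ) hγ0
    exact (h1.clm_apply hb).differentiableAt (by simp)
  have hspeed : speed G F γ 0 ≠ 0 := by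
    have hFγ : deriv (F ∘ γ) 0 = fderiv ℝ F (γ 0) (deriv γ 0) :=
      (HasFDerivAt.comp_hasDerivAt 0
        ((h.contDiffAt (hη.subset hγV0)).differentiableAt (by simp)).hasFDerivAt
        (hγ0.differentiableAt (by simp)).hasDerivAt).deriv
    rw [speed, hFγ]
    exact (h.len_pos (hη.subset hγV0) (h.fderiv_deriv_ne_zero (hη.subset hγV0) (hηs _ hγV0)
      (hη.null 0 hmem0 hγV0) (hdet 0 hmem0 hγV0) hl0)).ne'
  rw [h.regularSet_eq]
  refine ⟨?_, ?_, ?_⟩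
  · rw [hsq.boundedNear_iff hγ0 hγ.zero hlγ' hb hspan]
    refine eventually_congr (hκ.mono fun t ht => ?_)
    rw [ht.2, mul_eq_zero, or_iff_right ht.1]
  · rw [hsq.rationallyBounded_iff (b := fun t => η (γ t)) hγ0 hγ.zero hlγ' hspan, hzero]
  · rw [hsq.rationallyContinuous_iff hγ0 hγ.zero hlγ' hb hspan, hzero]
    refine and_congr_right fun hq => ?_
    have hder := (hasDerivAt_mul_of_eq_zero hKc hqd.hasDerivAt hq).congr_of_eventuallyEq
      (hκ.mono fun t ht => ht.2)
    rw [derivateCuspidalCurvature, div_eq_zero_iff, or_iff_left hspeed, hder.deriv, mul_eq_zero,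
      or_iff_right hκ0.1]
    exact ⟨fun h1 => h1.deriv, fun h1 => hqd.hasDerivAt.congr_deriv h1⟩

end IsFrontalOn

/-! ### From manifolds to coordinates -/

section Manifold

/-- The tangent map of a map that is smooth on an open set is smooth over it. -/
lemma contMDiffOn_tangentMap {E E' : Type*} [NormedAddCommGroup E] [NormedSpace ℝ E]
    [NormedAddCommGroup E'] [NormedSpace ℝ E'] {X Y : Type*}
    [TopologicalSpace X] [ChartedSpace E X] [IsManifold 𝓘(ℝ, E) ∞ X]
    [TopologicalSpace Y] [ChartedSpace E' Y] [IsManifold 𝓘(ℝ, E') ∞ Y] {k : X → Y} {s : Set X}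
    (hs : IsOpen s) (hk : ContMDiffOn 𝓘(ℝ, E) 𝓘(ℝ, E') ∞ k s) :
    ContMDiffOn 𝓘(ℝ, E).tangent 𝓘(ℝ, E').tangent ∞ (tangentMap 𝓘(ℝ, E) 𝓘(ℝ, E') k)
      (Bundle.TotalSpace.proj ⁻¹' s) := by
  refine (hk.contMDiffOn_tangentMapWithin (m := ∞) (by simp) hs.uniqueMDiffOn).congr ?_
  intro p hp
  exact (tangentMapWithin_eq_tangentMap (hs.uniqueMDiffOn p.1 hp)
    ((hk.contMDiffAt (hs.mem_nhds hp)).mdifferentiableAt (by simp))).symm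

lemma mdifferentiable_of_mem_maximalAtlas {M : Type*} [TopologicalSpace M] [ChartedSpace E3 M]
    {e' : OpenPartialHomeomorph M E3} (he' : e' ∈ IsManifold.maximalAtlas 𝓘(ℝ, E3) ∞ M) :
    e'.MDifferentiable 𝓘(ℝ, E3) 𝓘(ℝ, E3) :=
  ⟨(contMDiffOn_of_mem_maximalAtlas he').mdifferentiableOn (by simp),
    (contMDiffOn_symm_of_mem_maximalAtlas he').mdifferentiableOn (by simp)⟩

lemma isOpen_coordDomain {S M : Type*} [TopologicalSpace S] [TopologicalSpace M] {f : S → M}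
    {U : Set S} {e : OpenPartialHomeomorph S E2} {e' : OpenPartialHomeomorph M E3}
    (hf : Continuous f) (hU : IsOpen U) :
    IsOpen (coordDomain U f e e') := by
  have : coordDomain U f e e' = e.target ∩ e.symm ⁻¹' (U ∩ f ⁻¹' e'.source) := rfl
  rw [this]
  exact e.isOpen_inter_preimage_symm (hU.inter (e'.open_source.preimage hf))

variable {S : Type*} [TopologicalSpace S] [ChartedSpace E2 S]
  {M : Type*} [TopologicalSpace M] [ChartedSpace E3 M] [IsManifold 𝓘(ℝ, E3) ∞ M]
  {g : Metric3 M} {f : S → M} {U : Set S} {ν : ∀ q : S, TangentSpace 𝓘(ℝ, E3) (f q)}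
  {e : OpenPartialHomeomorph S E2} {e' : OpenPartialHomeomorph M E3}

lemma eq_sum_dx (a : E3) : a = a 0 • dx 0 + a 1 • dx 1 + a 2 • dx 2 := by
  ext i
  fin_cases i <;> simp [dx]

lemma ip_coordMetric (z a b : E3) : ip (coordMetric g e') z a b =
    g.inner (e'.symm z) (mfderiv 𝓘(ℝ, E3) 𝓘(ℝ, E3) e'.symm z a)
      (mfderiv 𝓘(ℝ, E3) 𝓘(ℝ, E3) e'.symm z b) := by
  have key : ∀ B : E3 →L[ℝ] E3 →L[ℝ] ℝ, B a b = ∑ i, ∑ j, B (dx i) (dx j) * a i * b j := by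
    intro B
    conv_lhs => rw [eq_sum_dx a, eq_sum_dx b]
    simp only [map_add, map_smul, add_apply, smul_apply, smul_eq_mul, Fin.sum_univ_three]
    ring
  let m : E3 →L[ℝ] E3 := mfderiv 𝓘(ℝ, E3) 𝓘(ℝ, E3) e'.symm z
  let k : E3 →L[ℝ] E3 →L[ℝ] ℝ := g.inner (e'.symm z)
  exact (key (k.bilinearComp m m)).symm

/-- The coordinate metric is the pullback of `g` under `e'.symm`, so `e'` preserves inner products.
-/
lemma ip_coordMetric_mfderiv (he' : e' ∈ IsManifold.maximalAtlas 𝓘(ℝ, E3) ∞ M) {y : M}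
    (hy : y ∈ e'.source) (v w : TangentSpace 𝓘(ℝ, E3) y) :
    ip (coordMetric g e') (e' y) (mfderiv 𝓘(ℝ, E3) 𝓘(ℝ, E3) e' y v)
      (mfderiv 𝓘(ℝ, E3) 𝓘(ℝ, E3) e' y w) = g.inner y v w := by
  have h1 : ∀ v : TangentSpace 𝓘(ℝ, E3) y, mfderiv 𝓘(ℝ, E3) 𝓘(ℝ, E3) e'.symm (e' y)
      (mfderiv 𝓘(ℝ, E3) 𝓘(ℝ, E3) e' y v) = v := fun v =>
    DFunLike.congr_fun ((mdifferentiable_of_mem_maximalAtlas he').symm_comp_deriv hy) v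
  -- All tangent spaces unfold to `E3`, so the base point can be replaced without transporting the
  -- vectors.
  have h2 : ∀ y' : M, y' = y → ∀ a b : E3,
      (g.inner y' : E3 →L[ℝ] E3 →L[ℝ] ℝ) a b = (g.inner y : E3 →L[ℝ] E3 →L[ℝ] ℝ) a b := by
    rintro _ rfl a b
    rfl
  refine (ip_coordMetric (g := g) (e' := e') (e' y) _ _).trans ?_
  refine (h2 _ (e'.left_inv hy) _ _).trans ?_
  exact congrArg₂ (fun a b : E3 => (g.inner y : E3 →L[ℝ] E3 →L[ℝ] ℝ) a b) (h1 v) (h1 w)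

lemma isMetricOn_coordMetric (he' : e' ∈ IsManifold.maximalAtlas 𝓘(ℝ, E3) ∞ M) :
    IsMetricOn (coordMetric g e') e'.target where
  isOpen := e'.open_target
  symm := fun y _ i j => g.symm _ _ _
  pos := by
    intro z hz a ha
    rw [ip_coordMetric]
    refine g.pos _ _ fun h0 => ha ?_
    have h1 : mfderiv 𝓘(ℝ, E3) 𝓘(ℝ, E3) e' (e'.symm z)
        (mfderiv 𝓘(ℝ, E3) 𝓘(ℝ, E3) e'.symm z a) = a :=
      DFunLike.congr_fun ((mdifferentiable_of_mem_maximalAtlas he').comp_symm_deriv hz) a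
    exact h1.symm.trans ((congrArg (mfderiv 𝓘(ℝ, E3) 𝓘(ℝ, E3) e' (e'.symm z)) h0).trans
      (map_zero _))
  smooth := by
    intro i j
    have hsymm := contMDiffOn_symm_of_mem_maximalAtlas he'
    have hv : ∀ v : E3, ContMDiffOn 𝓘(ℝ, E3) 𝓘(ℝ, E3).tangent ∞
        (fun z => (⟨e'.symm z, mfderiv 𝓘(ℝ, E3) 𝓘(ℝ, E3) e'.symm z v⟩ : TangentBundle 𝓘(ℝ, E3) M))
        e'.target := by
      intro v
      have hc : ContMDiff 𝓘(ℝ, E3) 𝓘(ℝ, E3).tangent ∞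
          (fun z : E3 => (⟨z, v⟩ : TangentBundle 𝓘(ℝ, E3) E3)) :=
        contMDiff_vectorSpace_iff_contDiff.2 contDiff_const
      exact (contMDiffOn_tangentMap e'.open_target hsymm).comp hc.contMDiffOn fun z hz => hz
    rw [← contMDiffOn_iff_contDiffOn]
    intro z hz
    have : ContMDiffWithinAt 𝓘(ℝ, E3) (𝓘(ℝ, E3).prod 𝓘(ℝ)) ∞
        (fun z => Bundle.TotalSpace.mk' ℝ (E := Bundle.Trivial M ℝ) (e'.symm z)
          (g.inner (e'.symm z) (mfderiv 𝓘(ℝ, E3) 𝓘(ℝ, E3) e'.symm z (dx i))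
            (mfderiv 𝓘(ℝ, E3) 𝓘(ℝ, E3) e'.symm z (dx j)))) e'.target z := by
      apply ContMDiffWithinAt.clm_bundle_apply₂ (F₁ := E3) (F₂ := E3)
      · exact ContMDiffAt.comp_contMDiffWithinAt z g.contMDiff.contMDiffAt (hsymm z hz)
      · exact hv (dx i) z hz
      · exact hv (dx j) z hz
    simp only [Bundle.contMDiffWithinAt_totalSpace] at this
    exact this.2

lemma isFrontalOn_coord (hf : ContMDiff 𝓘(ℝ, E2) 𝓘(ℝ, E3) ∞ f) (hU : IsOpen U)
    (hν : IsUnitNormalOn g f ν U) (he : e ∈ IsManifold.maximalAtlas 𝓘(ℝ, E2) ∞ S)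
    (he' : e' ∈ IsManifold.maximalAtlas 𝓘(ℝ, E3) ∞ M) :
    IsFrontalOn (coordDomain U f e e') e'.target (coordMetric g e') (coordMap f e e')
      (coordField f ν e e') where
  isOpen := isOpen_coordDomain hf.continuous hU
  metric := isMetricOn_coordMetric he'
  maps := fun x hx => e'.map_source hx.2.2
  smooth := by
    rw [← contMDiffOn_iff_contDiffOn]
    refine (contMDiffOn_of_mem_maximalAtlas he').comp (t := e'.source) (f := fun x => f (e.symm x)) ?_
      fun x hx => hx.2.2
    exact hf.comp_contMDiffOn ((contMDiffOn_symm_of_mem_maximalAtlas he).mono fun x hx => hx.1)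
  smooth_normal := by
    rw [← contMDiffOn_iff_contDiffOn]
    have h1 : ContMDiffOn 𝓘(ℝ, E2) 𝓘(ℝ, E3).tangent ∞
        (fun x => (⟨f (e.symm x), ν (e.symm x)⟩ : TangentBundle 𝓘(ℝ, E3) M))
        (coordDomain U f e e') :=
      hν.smooth.comp ((contMDiffOn_symm_of_mem_maximalAtlas he).mono fun x hx => hx.1)
        fun x hx => hx.2.1
    have h2 := (contMDiffOn_tangentMap e'.open_source (contMDiffOn_of_mem_maximalAtlas he')).comp h1
      fun x hx => hx.2.2
    exact (contMDiff_snd_tangentBundle_modelSpace E3 𝓘(ℝ, E3)).comp_contMDiffOn h2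
  unit := by
    intro x hx
    exact (ip_coordMetric_mfderiv he' hx.2.2 _ _).trans (hν.unit _ hx.2.1)
  normal := by
    intro x hx a
    have d1 : MDifferentiableAt 𝓘(ℝ, E2) 𝓘(ℝ, E2) e.symm x :=
      (contMDiffAt_symm_of_mem_maximalAtlas he hx.1).mdifferentiableAt (by simp)
    have d2 : MDifferentiableAt 𝓘(ℝ, E2) 𝓘(ℝ, E3) f (e.symm x) :=
      hf.contMDiffAt.mdifferentiableAt (by simp)
    have d3 : MDifferentiableAt 𝓘(ℝ, E3) 𝓘(ℝ, E3) e' (f (e.symm x)) :=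
      (contMDiffAt_of_mem_maximalAtlas he' hx.2.2).mdifferentiableAt (by simp)
    have hd : mfderiv 𝓘(ℝ, E2) 𝓘(ℝ, E3) (coordMap f e e') x =
        (mfderiv 𝓘(ℝ, E3) 𝓘(ℝ, E3) e' (f (e.symm x))).comp
          ((mfderiv 𝓘(ℝ, E2) 𝓘(ℝ, E3) f (e.symm x)).comp
            (mfderiv 𝓘(ℝ, E2) 𝓘(ℝ, E2) e.symm x)) := by
      rw [← mfderiv_comp x d2 d1]
      exact mfderiv_comp x d3 (d2.comp x d1)
    rw [← mfderiv_eq_fderiv, hd]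
    exact (ip_coordMetric_mfderiv he' hx.2.2 _ _).trans (hν.normal _ hx.2.1 _)

end Manifold

end FrontalGeometry

end

/-! ### The theorem for arbitrary charts of the two manifolds. -/

theorem proposition2
    {S : Type*} [TopologicalSpace S] [ChartedSpace FrontalGeometry.E2 S]
    [IsManifold 𝓘(ℝ, FrontalGeometry.E2) ∞ S]
    {M : Type*} [TopologicalSpace M] [ChartedSpace FrontalGeometry.E3 M]
    [IsManifold 𝓘(ℝ, FrontalGeometry.E3) ∞ M]
    (g : FrontalGeometry.Metric3 M) (f : S → M) (hf : FrontalGeometry.IsFrontal g f)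
    -- the point, and a unit normal field near it
    (p : S) (U : Set S) (hU : IsOpen U) (hpU : p ∈ U)
    (ν : ∀ q : S, TangentSpace 𝓘(ℝ, FrontalGeometry.E3) (f q))
    (hν : FrontalGeometry.IsUnitNormalOn g f ν U)
    -- an arbitrary coordinate system of `S` centered at `p`, an arbitrary one of `M` around `f p`
    (e : OpenPartialHomeomorph S FrontalGeometry.E2)
    (he : e ∈ IsManifold.maximalAtlas 𝓘(ℝ, FrontalGeometry.E2) ∞ S)
    (hpe : p ∈ e.source) (hp0 : e p = 0)
    (e' : OpenPartialHomeomorph M FrontalGeometry.E3)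
    (he' : e' ∈ IsManifold.maximalAtlas 𝓘(ℝ, FrontalGeometry.E3) ∞ M)
    (hpe' : f p ∈ e'.source)
    -- the coordinate expressions of all data
    (D : Set FrontalGeometry.E2) (hD : D = FrontalGeometry.coordDomain U f e e')
    (G : FrontalGeometry.E3 → Matrix (Fin 3) (Fin 3) ℝ)
    (hG : G = FrontalGeometry.coordMetric g e')
    (F N : FrontalGeometry.E2 → FrontalGeometry.E3)
    (hF : F = FrontalGeometry.coordMap f e e')
    (hN : N = FrontalGeometry.coordField f ν e e')
    -- `p` is a singular point of the first kind
    (hp : FrontalGeometry.IsFirstKind D G F N)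
    -- an arbitrary singular curve and an arbitrary extended null vector field
    (ε : ℝ) (γ : ℝ → FrontalGeometry.E2)
    (hγ : FrontalGeometry.IsSingularCurve D F ε γ)
    (V : Set FrontalGeometry.E2) (η : FrontalGeometry.E2 → FrontalGeometry.E2)
    (hη : FrontalGeometry.IsExtendedNullField D F ε γ V η) :
    (FrontalGeometry.BoundedNear D (FrontalGeometry.regularSet D F)
        (FrontalGeometry.meanCurvature G F N) ↔
      ∀ᶠ t in 𝓝 (0 : ℝ), FrontalGeometry.cuspidalCurvature G F γ η t = 0) ∧
    (FrontalGeometry.RationallyBounded D (FrontalGeometry.regularSet D F)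
        (FrontalGeometry.meanCurvature G F N) ↔
      FrontalGeometry.cuspidalCurvature G F γ η 0 = 0) ∧
    (FrontalGeometry.RationallyContinuous D (FrontalGeometry.regularSet D F)
        (FrontalGeometry.meanCurvature G F N) ↔
      FrontalGeometry.cuspidalCurvature G F γ η 0 = 0 ∧
        FrontalGeometry.derivateCuspidalCurvature G F γ η = 0) := by
  subst hD hG hF hN
  -- Transversality of the null direction to the curve enters through the positivity of the frame in
  -- `hη`.
  exact (FrontalGeometry.isFrontalOn_coord hf.1 hU hν he he').meanCurvature_criteria hp.1 hγ hη
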